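/- Throughout, all groups are finite. A subgroup $M$ of a group $G$ is called modular in $G$ if $\langle X, M\cap Z\rangle=\langle X,M\rangle\cap Z$ for all $X\le Z\le G$, and $\langle M, Y\cap Z\rangle=\langle M,Y\rangle\cap Z$ for all $Y\le G$ and all $Z$ with $M\le Z\le G$. A subgroup $H$ of $G$ is called submodular in $G$ if there is a chain of subgroups $H=H_0\le H_1\le\dots\le H_s=G$ such that $H_{i-1}$ is modular in $H_i$ for $i=1,\dots,s$. Let $sm\mathfrak{U}$ be the class of all groups in which every Sylow subgroup (for every prime) is submodular. A formation is a class of groups $\mathfrak{F}$, closed under isomorphism, such that every quotient of a group in $\mathfrak{F}$ lies in $\mathfrak{F}$, and such that $G/A\in\mathfrak{F}$ and $G/B\in\mathfrak{F}$, with $A,B$ normal in $G$, imply $G/(A\cap B)\in\mathfrak{F}$. A local screen is a function $f$ that assigns to every prime $p$ a formation $f(p)$. Let $LF(f)$ be the class of all groups $G$ such that $G/C_G(H/K)\in f(p)$ for every chief factor $H/K$ of $G$ and every prime $p$ dividing $|H/K|$. Here $C_G(H/K)$ is the set of all $g\in G$ with $[g,h]\in K$ for all $h\in H$. A formation $\mathfrak{F}$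 is called local if $\mathfrak{F}=LF(f)$ for some local screen $f$, and $f$ is then called a local screen of $\mathfrak{F}$. Theorem 3.6. The class $sm\mathfrak{U}$ is a local formation. It has the local screen $f$ such that, for every prime $p$, $f(p)$ is the class of all soluble groups all of whose Sylow subgroups are abelian, of exponent dividing $p-1$, and of squarefree exponent. That is, $sm\mathfrak{U}$ is a formation, every $f(p)$ is a formation, and $sm\mathfrak{U}=LF(f)$. -/

import Mathlib

universe u

/-! ## Modular and submodular subgroups -/

/-- A subgroup `M` of `G` is modular in `G` (a modular element, in the sense of Kurosh, of the
subgroup lattice of `G`) if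
* `⟨X, M ∩ Z⟩ = ⟨X, M⟩ ∩ Z` for all `X ≤ Z ≤ G`, and
* `⟨M, Y ∩ Z⟩ = ⟨M, Y⟩ ∩ Z` for all `Y ≤ G` and `M ≤ Z ≤ G`. -/
def IsModularSubgroup {G : Type u} [Group G] (M : Subgroup G) : Prop :=
  (∀ X Z : Subgroup G, X ≤ Z → X ⊔ (M ⊓ Z) = (X ⊔ M) ⊓ Z) ∧
  (∀ Y Z : Subgroup G, M ≤ Z → M ⊔ (Y ⊓ Z) = (M ⊔ Y) ⊓ Z)

/-- `H` is submodular in `G` if there is a chain `H = H₀ ≤ H₁ ≤ ⋯ ≤ Hₛ = G` of subgroups in which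
each member is a modular subgroup of the next one. -/
def IsSubmodularSubgroup {G : Type u} [Group G] (H : Subgroup G) : Prop :=
  ∃ (s : ℕ) (C : ℕ → Subgroup G), C 0 = H ∧ C s = ⊤ ∧
    ∀ i < s, C i ≤ C (i + 1) ∧ IsModularSubgroup ((C i).subgroupOf (C (i + 1)))

theorem IsModularSubgroup.map_equiv {G G' : Type u} [Group G] [Group G'] (e : G ≃* G')
    {M : Subgroup G} (hM : IsModularSubgroup M) : IsModularSubgroup (M.map e.toMonoidHom) := by
  have key : ∀ Z : Subgroup G', ∃ W : Subgroup G, W.map e.toMonoidHom = Z := fun Z =>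
    ⟨Z.comap e.toMonoidHom, Subgroup.map_comap_eq_self_of_surjective e.surjective Z⟩
  have hinj : Function.Injective e.toMonoidHom := e.injective
  refine ⟨fun X Z h => ?_, fun Y Z h => ?_⟩
  · obtain ⟨X, rfl⟩ := key X
    obtain ⟨Z, rfl⟩ := key Z
    rw [Subgroup.map_le_map_iff_of_injective hinj] at h
    rw [← Subgroup.map_inf _ _ _ hinj, ← Subgroup.map_sup, ← Subgroup.map_sup,
      ← Subgroup.map_inf _ _ _ hinj, hM.1 X Z h]
  · obtain ⟨Y, rfl⟩ := key Y
    obtain ⟨Z, rfl⟩ := key Z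
    rw [Subgroup.map_le_map_iff_of_injective hinj] at h
    rw [← Subgroup.map_inf _ _ _ hinj, ← Subgroup.map_sup, ← Subgroup.map_sup,
      ← Subgroup.map_inf _ _ _ hinj, hM.2 Y Z h]

theorem IsSubmodularSubgroup.map_equiv {G G' : Type u} [Group G] [Group G'] (e : G ≃* G')
    {H : Subgroup G} (hH : IsSubmodularSubgroup H) :
    IsSubmodularSubgroup (H.map e.toMonoidHom) := by
  obtain ⟨s, C, h0, hs, hC⟩ := hH
  refine ⟨s, fun i => (C i).map e.toMonoidHom, by simp [h0], ?_, fun i hi => ?_⟩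
  · simp only [hs]
    exact Subgroup.map_top_of_surjective e.toMonoidHom e.surjective
  · refine ⟨Subgroup.map_mono (hC i hi).1, ?_⟩
    have h := (hC i hi).2.map_equiv (e.subgroupMap (C (i + 1)))
    suffices heq : ((C i).map e.toMonoidHom).subgroupOf ((C (i + 1)).map e.toMonoidHom) =
        ((C i).subgroupOf (C (i + 1))).map (e.subgroupMap (C (i + 1))).toMonoidHom by
      exact heq ▸ h
    ext ⟨x, hx⟩
    obtain ⟨y, hy, rfl⟩ := hx
    simp only [Subgroup.mem_subgroupOf, Subgroup.mem_map]
    constructor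
    · rintro ⟨z, hz, hzy⟩
      have : z = y := e.injective hzy
      subst this
      exact ⟨⟨z, hy⟩, by simpa [Subgroup.mem_subgroupOf] using hz, rfl⟩
    · rintro ⟨⟨z, hz⟩, hz', hzy⟩
      have : z = y := e.injective (congrArg Subtype.val hzy)
      subst this
      exact ⟨z, by simpa [Subgroup.mem_subgroupOf] using hz', rfl⟩

/-! ## Chief factors -/

/-- `H / K` is a chief factor of `G`: `K < H` are normal subgroups of `G` and no normal subgroup
of `G` lies strictly between them. -/
structure IsChiefFactor {G : Type u} [Group G] (H K : Subgroup G) : Prop where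
  normal_top : H.Normal
  normal_bot : K.Normal
  lt : K < H
  eq_or_eq : ∀ L : Subgroup G, L.Normal → K ≤ L → L ≤ H → L = K ∨ L = H

/-- `C_G(H / K)`, the preimage in `G` of the centralizer of `H / K` in `G / K`. -/
def factorCentralizer {G : Type u} [Group G] (H K : Subgroup G) [K.Normal] : Subgroup G :=
  (Subgroup.centralizer ((H.map (QuotientGroup.mk' K) : Subgroup (G ⧸ K)) : Set (G ⧸ K))).comap
    (QuotientGroup.mk' K)

instance factorCentralizer_normal {G : Type u} [Group G] (H K : Subgroup G) [H.Normal]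
    [K.Normal] : (factorCentralizer H K).Normal := by
  have : (H.map (QuotientGroup.mk' K)).Normal :=
    Subgroup.Normal.map inferInstance _ (QuotientGroup.mk'_surjective K)
  unfold factorCentralizer
  infer_instance

theorem mem_factorCentralizer {G : Type u} [Group G] (H K : Subgroup G) [K.Normal] {g : G} :
    g ∈ factorCentralizer H K ↔ ∀ h ∈ H, (h * g)⁻¹ * (g * h) ∈ K := by
  simp only [factorCentralizer, Subgroup.mem_comap, Subgroup.mem_centralizer_iff]
  constructor
  · intro hg h hh
    have := hg (QuotientGroup.mk' K h) ⟨h, hh, rfl⟩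
    rw [← map_mul, ← map_mul] at this
    exact QuotientGroup.eq.1 this
  · rintro hg _ ⟨h, hh, rfl⟩
    rw [← map_mul, ← map_mul]
    exact QuotientGroup.eq.2 (hg h hh)

/-! ## Classes of finite groups, formations, local formations -/

/-- A class of (finite) groups: a property of groups which implies finiteness and is invariant
under isomorphism. -/
structure GroupClass where
  Mem : ∀ (G : Type u) [Group G], Prop
  finite : ∀ {G : Type u} [Group G], Mem G → Finite G
  congr : ∀ {G G' : Type u} [Group G] [Group G'], (G ≃* G') → Mem G → Mem G'

namespace GroupClass

/-- A formation: a class of groups that contains `G / N` whenever it contains `G`, and contains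
`G / (A ∩ B)` whenever it contains `G / A` and `G / B`. -/
structure IsFormation (F : GroupClass.{u}) : Prop where
  quotient : ∀ (G : Type u) [Group G] (N : Subgroup G) [N.Normal], F.Mem G → F.Mem (G ⧸ N)
  inf : ∀ (G : Type u) [Group G] [Finite G] (A B : Subgroup G) [A.Normal] [B.Normal],
    F.Mem (G ⧸ A) → F.Mem (G ⧸ B) → F.Mem (G ⧸ (A ⊓ B))

/-- A local screen: a function from the primes to the formations. -/
def IsLocalScreen (f : Nat.Primes → GroupClass.{u}) : Prop :=
  ∀ p, (f p).IsFormation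

/-- `LF(f)`: the class of finite groups `G` such that `G / C_G(H / K) ∈ f p` for every chief factor
`H / K` of `G` and every prime divisor `p` of `|H / K|`. -/
def localClass (f : Nat.Primes → GroupClass.{u}) : GroupClass.{u} where
  Mem G _ := Finite G ∧ ∀ (H K : Subgroup G) [H.Normal] [K.Normal], IsChiefFactor H K →
    ∀ p : Nat.Primes, (p : ℕ) ∣ K.relIndex H → (f p).Mem (G ⧸ factorCentralizer H K)
  finite h := h.1
  congr := by
    intro G G' _ _ e ⟨hfin, h⟩
    refine ⟨Finite.of_equiv G e.toEquiv, ?_⟩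
    intro H K _ _ hc p hp
    have hsurj : Function.Surjective e.toMonoidHom := e.surjective
    have hmc := Subgroup.map_comap_eq_self_of_surjective hsurj
    have hcm : ∀ L : Subgroup G, (L.map e.toMonoidHom).comap e.toMonoidHom = L := fun L =>
      Subgroup.comap_map_eq_self_of_injective e.injective L
    have hc' : IsChiefFactor (H.comap e.toMonoidHom) (K.comap e.toMonoidHom) := by
      refine ⟨inferInstance, inferInstance,
        (Subgroup.comap_lt_comap_of_surjective hsurj).2 hc.lt, fun L hL hKL hLH => ?_⟩
      have h1 : K ≤ L.map e.toMonoidHom := by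
        rw [← hmc K]; exact Subgroup.map_mono hKL
      have h2 : L.map e.toMonoidHom ≤ H := by
        rw [← hmc H]; exact Subgroup.map_mono hLH
      rcases hc.eq_or_eq _ (hL.map _ hsurj) h1 h2 with h3 | h3
      · left; rw [← h3, hcm]
      · right; rw [← h3, hcm]
    have hp' : (p : ℕ) ∣ (K.comap e.toMonoidHom).relIndex (H.comap e.toMonoidHom) := by
      rwa [Subgroup.relIndex_comap, hmc]
    refine (f p).congr (QuotientGroup.congr _ _ e ?_) (h _ _ hc' p hp')
    ext x
    obtain ⟨y, rfl⟩ := e.surjective x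
    have hy : e y ∈ (factorCentralizer (H.comap e.toMonoidHom) (K.comap e.toMonoidHom)).map
        (e : G →* G') ↔
        y ∈ factorCentralizer (H.comap e.toMonoidHom) (K.comap e.toMonoidHom) :=
      Subgroup.mem_map_iff_mem e.injective
    rw [hy, mem_factorCentralizer, mem_factorCentralizer]
    constructor
    · intro hx k hk
      obtain ⟨k, rfl⟩ := e.surjective k
      simpa using hx k hk
    · intro hx k hk
      simpa using hx (e k) hk

/-- `f` is a local screen of the class `F`: it is a local screen and `F = LF(f)`. -/
def HasLocalScreen (F : GroupClass.{u}) (f : Nat.Primes → GroupClass.{u}) : Prop :=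
  IsLocalScreen f ∧ F = localClass f

/-- A local formation: a formation which has a local screen. -/
def IsLocalFormation (F : GroupClass.{u}) : Prop :=
  F.IsFormation ∧ ∃ f : Nat.Primes → GroupClass.{u}, F.HasLocalScreen f

/-- The intersection of two classes of groups. -/
def inter (X Y : GroupClass.{u}) : GroupClass.{u} where
  Mem G _ := X.Mem G ∧ Y.Mem G
  finite h := X.finite h.1
  congr e h := ⟨X.congr e h.1, Y.congr e h.2⟩

/-- `𝔖`: the finite soluble groups. -/
def soluble : GroupClass.{u} where
  Mem G _ := Finite G ∧ Group.IsSolvable G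
  finite h := h.1
  congr := by
    intro G G' _ _ e ⟨hfin, h⟩
    exact ⟨Finite.of_equiv G e.toEquiv, Group.isSolvable_of_surjective (f := e.toMonoidHom) e.surjective⟩

/-- `𝔄(n)`: the finite abelian groups of exponent dividing `n`. -/
def abelianOfExponentDvd (n : ℕ) : GroupClass.{u} where
  Mem G _ := Finite G ∧ (∀ a b : G, a * b = b * a) ∧ Monoid.exponent G ∣ n
  finite h := h.1
  congr := by
    intro G G' _ _ e ⟨hfin, hab, hexp⟩
    refine ⟨Finite.of_equiv G e.toEquiv, fun a b => e.symm.injective ?_, ?_⟩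
    · rw [map_mul, map_mul, hab]
    · rwa [← Monoid.exponent_eq_of_mulEquiv e]

/-- `𝔅`: the finite abelian groups of squarefree exponent. -/
def abelianOfSquarefreeExponent : GroupClass.{u} where
  Mem G _ := Finite G ∧ (∀ a b : G, a * b = b * a) ∧ Squarefree (Monoid.exponent G)
  finite h := h.1
  congr := by
    intro G G' _ _ e ⟨hfin, hab, hexp⟩
    refine ⟨Finite.of_equiv G e.toEquiv, fun a b => e.symm.injective ?_, ?_⟩
    · rw [map_mul, map_mul, hab]
    · rwa [← Monoid.exponent_eq_of_mulEquiv e]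

/-- `(G ∈ 𝔖 | Syl(G) ⊆ X)`: the finite soluble groups all of whose Sylow subgroups, for all
primes, belong to the class `X`. -/
def solubleWithSylowIn (X : GroupClass.{u}) : GroupClass.{u} where
  Mem G _ := soluble.Mem G ∧ ∀ (q : ℕ) [Fact q.Prime] (P : Sylow q G), X.Mem P
  finite h := soluble.finite h.1
  congr := by
    intro G G' _ _ e ⟨hs, h⟩
    refine ⟨soluble.congr e hs, fun q _ P => ?_⟩
    let Q : Sylow q G := P.comapOfInjective e.toMonoidHom e.injective
      (by rw [MonoidHom.range_eq_top.2 e.surjective]; exact le_top)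
    have hQ : (Q : Subgroup G).map e.toMonoidHom = P :=
      Subgroup.map_comap_eq_self_of_surjective e.surjective _
    exact X.congr ((e.subgroupMap (Q : Subgroup G)).trans (MulEquiv.subgroupCongr hQ)) (h q Q)

/-- `sm𝔘`: the finite groups all of whose Sylow subgroups, for all primes, are submodular. -/
def submodularSylow : GroupClass.{u} where
  Mem G _ := Finite G ∧
    ∀ (q : ℕ) [Fact q.Prime] (P : Sylow q G), IsSubmodularSubgroup (P : Subgroup G)
  finite h := h.1
  congr := by
    intro G G' _ _ e ⟨hfin, h⟩
    refine ⟨Finite.of_equiv G e.toEquiv, fun q _ P => ?_⟩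
    let Q : Sylow q G := P.comapOfInjective e.toMonoidHom e.injective
      (by rw [MonoidHom.range_eq_top.2 e.surjective]; exact le_top)
    have hQ : (Q : Subgroup G).map e.toMonoidHom = P :=
      Subgroup.map_comap_eq_self_of_surjective e.surjective _
    exact hQ ▸ (h q Q).map_equiv e

end GroupClass

/-! Both inclusions rest on the action of a `q`-subgroup `Q` on an elementary abelian normal
`p`-subgroup `N`.

Suppose that `p ≠ q` and `Q` is submodular. If `C` is modular in `D`, then `C` induces power
automorphisms on `(D ⊓ N) / (C ⊓ N)`. So commutators act trivially there, and so does `x ^ (p - 1)`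
by Fermat; the modular law applied to a conjugate of `x` shows the same for `x ^ q`. Coprimality
carries this along the chain from `Q`, so that `Q / C_Q(N)` is abelian of exponent dividing `p - 1`
and `q` (`SubmodularIn.commute_commutator` and its companions). These are the conditions of the
screen.

To use this on chief factors one needs solubility. By induction on the order, the Sylow subgroup for
the largest prime is normal (`SylowSubmodular.normal_and_isSolvable_of_card`). A non-simple
counterexample falls to the action lemmas. In a simple one (`SimpleSylowConfiguration.elim`)
modularity forces the Sylow `p`-subgroups to have order `p`, and the Sylow subgroup for the smallest
prime to be abelian and self-normalizing, against Burnside's transfer theorem. The same normality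
shows that Sylow `p`-subgroups centralize `p`-chief factors.

Conversely, if `Q` satisfies the conditions of the screen on `N`, it acts by scalars on a minimal
normal subgroup `L ≤ N` of `QN`, so `L` has order `p`. Then `QL / C_Q(L)` has order dividing `p *
q`, and all subgroups of such a group are modular. Hence `Q` is modular in `QL`, and induction makes
it submodular in `QN` (`ActsAbelianly.submodularIn_top`). Climbing a chief series of `G` finishes
the proof. -/

/-! ## Modular elements of intervals of the subgroup lattice -/

/-- `M` is a modular subgroup of `H`, where both are subgroups of an ambient group. -/
structure ModularIn {G : Type*} [Group G] (M H : Subgroup G) : Prop where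
  le : M ≤ H
  sup_inf : ∀ X Z : Subgroup G, X ≤ Z → Z ≤ H → X ⊔ (M ⊓ Z) = (X ⊔ M) ⊓ Z
  sup_inf' : ∀ Y Z : Subgroup G, Y ≤ H → M ≤ Z → Z ≤ H → M ⊔ (Y ⊓ Z) = (M ⊔ Y) ⊓ Z

/-- `M` is a submodular subgroup of `H`, where both are subgroups of an ambient group. -/
def SubmodularIn {G : Type*} [Group G] (M H : Subgroup G) : Prop :=
  Relation.ReflTransGen ModularIn M H

section Basic

variable {G G' : Type*} [Group G] [Group G']

/-- The second identity for `M ⊓ U` uses both identities for `M`: the first shows that enlarging `Z`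
to `Z ⊔ M` adds nothing inside `H ⊓ U`, and the second applies to `Z ⊔ M`, which contains `M`. -/
theorem ModularIn.inf {M H : Subgroup G} (h : ModularIn M H) (U : Subgroup G) :
    ModularIn (M ⊓ U) (H ⊓ U) := by
  refine ⟨inf_le_inf_right _ h.le, fun X Z hXZ hZ => ?_, fun Y Z hY hMZ hZ => ?_⟩
  · have hZH : Z ≤ H := hZ.trans inf_le_left
    have hZU : Z ≤ U := hZ.trans inf_le_right
    apply le_antisymm
    · exact sup_le (le_inf le_sup_left hXZ) (le_inf (inf_le_left.trans le_sup_right) inf_le_right)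
    · calc (X ⊔ M ⊓ U) ⊓ Z ≤ (X ⊔ M) ⊓ Z := inf_le_inf_right _ (sup_le_sup_left inf_le_left _)
        _ = X ⊔ (M ⊓ Z) := (h.sup_inf X Z hXZ hZH).symm
        _ ≤ _ := sup_le_sup_left (le_inf (le_inf inf_le_left (inf_le_right.trans hZU))
          inf_le_right) _
  · have hZH : Z ≤ H := hZ.trans inf_le_left
    have hZU : Z ≤ U := hZ.trans inf_le_right
    have hYH : Y ≤ H := hY.trans inf_le_left
    have hYU : Y ≤ U := hY.trans inf_le_right
    apply le_antisymm
    · exact sup_le (le_inf le_sup_left hMZ) (le_inf (inf_le_left.trans le_sup_right) inf_le_right)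
    · -- everything is computed inside `H ⊓ U`
      have hZM : (Z ⊔ M) ⊓ (H ⊓ U) ≤ Z := by
        rw [← h.sup_inf Z (H ⊓ U) hZ inf_le_left]
        exact sup_le le_rfl ((inf_le_inf_left _ inf_le_right).trans hMZ)
      have h1 : (M ⊔ Y) ⊓ (Z ⊔ M) = M ⊔ (Y ⊓ Z) := by
        rw [← h.sup_inf' Y (Z ⊔ M) hYH le_sup_right (sup_le hZH h.le)]
        congr 1
        exact le_antisymm (le_inf inf_le_left ((le_inf inf_le_right (inf_le_left.trans hY)).trans
          hZM)) (inf_le_inf_left _ le_sup_left)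
      calc (M ⊓ U ⊔ Y) ⊓ Z ≤ ((M ⊔ Y) ⊓ (Z ⊔ M)) ⊓ (H ⊓ U) :=
            le_inf (le_inf (inf_le_left.trans (sup_le_sup_right inf_le_left _))
              (inf_le_right.trans le_sup_left)) (inf_le_right.trans hZ)
        _ = (Y ⊓ Z ⊔ M) ⊓ (H ⊓ U) := by rw [h1, sup_comm]
        _ = Y ⊓ Z ⊔ (M ⊓ (H ⊓ U)) :=
            (h.sup_inf _ _ (inf_le_left.trans hY) inf_le_left).symm
        _ ≤ _ := sup_le le_sup_right ((inf_le_inf_left _ inf_le_right).trans le_sup_left)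

/-- Elements of `A` and `B` with the same image differ by an element of `f.ker ⊓ H`, which `B`
absorbs. -/
theorem Subgroup.map_inf_of_ker_inf_le (f : G →* G') {A B H : Subgroup G} (hA : A ≤ H)
    (hB : B ≤ H) (hk : f.ker ⊓ H ≤ B) : (A ⊓ B).map f = A.map f ⊓ B.map f := by
  refine le_antisymm (Subgroup.map_inf_le A B f) ?_
  rintro _ ⟨⟨a, ha, rfl⟩, ⟨b, hb, hab⟩⟩
  refine ⟨a, ⟨ha, ?_⟩, rfl⟩
  have : b⁻¹ * a ∈ B := hk ⟨by simp [hab], H.mul_mem (H.inv_mem (hB hb)) (hA ha)⟩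
  simpa using B.mul_mem hb this

theorem ModularIn.map {M H : Subgroup G} (h : ModularIn M H) (f : G →* G') :
    ModularIn (M.map f) (H.map f) := by
  -- Each subgroup of `H.map f` is the image of its full preimage in `H`, so both identities can be
  -- checked upstairs.
  have key : ∀ Z : Subgroup G', Z ≤ H.map f → (Z.comap f ⊓ H).map f = Z := fun Z hZ => by
    rw [inf_comm, Subgroup.map_inf_of_ker_inf_le f (H := ⊤) le_top le_top
      (inf_le_left.trans (Subgroup.ker_le_comap f Z)), Subgroup.map_comap_eq, inf_comm,
      inf_assoc]
    exact le_antisymm (inf_le_right.trans inf_le_left)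
      (le_inf (hZ.trans (Subgroup.map_le_range f H)) (le_inf le_rfl hZ))
  have hker : ∀ Z : Subgroup G', f.ker ⊓ H ≤ Z.comap f ⊓ H := fun Z =>
    inf_le_inf_right _ (Subgroup.ker_le_comap f Z)
  refine ⟨Subgroup.map_mono h.le, fun X Z hXZ hZ => ?_, fun Y Z hY hMZ hZ => ?_⟩
  · rw [← key X (hXZ.trans hZ), ← key Z hZ]
    have h1 : X.comap f ⊓ H ≤ Z.comap f ⊓ H := inf_le_inf_right _ (Subgroup.comap_mono hXZ)
    rw [← Subgroup.map_inf_of_ker_inf_le f h.le inf_le_right (hker Z), ← Subgroup.map_sup,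
      ← Subgroup.map_sup, ← Subgroup.map_inf_of_ker_inf_le f (sup_le inf_le_right h.le)
      inf_le_right (hker Z), h.sup_inf _ _ h1 inf_le_right]
  · rw [← key Y hY, ← key Z hZ]
    have h1 : M ≤ Z.comap f ⊓ H := le_inf (Subgroup.map_le_iff_le_comap.1 hMZ) h.le
    rw [← Subgroup.map_inf_of_ker_inf_le f inf_le_right inf_le_right (hker Z), ← Subgroup.map_sup,
      ← Subgroup.map_sup, ← Subgroup.map_inf_of_ker_inf_le f (sup_le h.le inf_le_right)
      inf_le_right (hker Z), h.sup_inf' _ _ inf_le_right h1 inf_le_right]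

theorem ModularIn.of_map_injective {M H : Subgroup G} {f : G →* G'} (hf : Function.Injective f)
    (h : ModularIn (M.map f) (H.map f)) : ModularIn M H := by
  refine ⟨(Subgroup.map_le_map_iff_of_injective hf).1 h.le, fun X Z hXZ hZ => ?_,
    fun Y Z hY hMZ hZ => ?_⟩ <;> apply Subgroup.map_injective hf
  · rw [Subgroup.map_sup, Subgroup.map_inf _ _ _ hf, Subgroup.map_inf _ _ _ hf, Subgroup.map_sup]
    exact h.sup_inf _ _ (Subgroup.map_mono hXZ) (Subgroup.map_mono hZ)
  · rw [Subgroup.map_sup, Subgroup.map_inf _ _ _ hf, Subgroup.map_inf _ _ _ hf, Subgroup.map_sup]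
    exact h.sup_inf' _ _ (Subgroup.map_mono hY) (Subgroup.map_mono hMZ) (Subgroup.map_mono hZ)

theorem ModularIn.comap_injective {M H : Subgroup G'} (h : ModularIn M H) {f : G →* G'}
    (hf : Function.Injective f) : ModularIn (M.comap f) (H.comap f) := by
  apply ModularIn.of_map_injective hf
  rw [Subgroup.map_comap_eq, Subgroup.map_comap_eq, inf_comm, inf_comm f.range]
  exact h.inf _

/-- An identity in the image lifts up to an element of the kernel, and `M.comap f` contains the
kernel. -/
theorem ModularIn.comap_surjective {M H : Subgroup G'} (h : ModularIn M H) {f : G →* G'}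
    (hf : Function.Surjective f) : ModularIn (M.comap f) (H.comap f) := by
  have hmc := Subgroup.map_comap_eq_self_of_surjective hf
  refine ⟨Subgroup.comap_mono h.le, fun X Z hXZ hZ => ?_, fun Y Z hY hMZ hZ => ?_⟩
  · apply le_antisymm
    · exact sup_le (le_inf le_sup_left hXZ) (le_inf (inf_le_left.trans le_sup_right) inf_le_right)
    rintro g ⟨hg, hgZ⟩
    have hinf : (M.comap f ⊓ Z).map f = M ⊓ Z.map f := by
      rw [inf_comm, Subgroup.map_inf_of_ker_inf_le f (H := ⊤) le_top le_top
        (inf_le_left.trans (Subgroup.ker_le_comap f M)), hmc, inf_comm]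
    have h1 : f g ∈ (X ⊔ M.comap f ⊓ Z).map f := by
      rw [Subgroup.map_sup, hinf, h.sup_inf _ _ (Subgroup.map_mono hXZ)
        (Subgroup.map_le_iff_le_comap.2 hZ), ← hmc M, ← Subgroup.map_sup]
      exact ⟨⟨g, hg, rfl⟩, ⟨g, hgZ, rfl⟩⟩
    obtain ⟨w, hw, hwg⟩ := h1
    have hwZ : w ∈ Z := (sup_le hXZ inf_le_right : X ⊔ M.comap f ⊓ Z ≤ Z) hw
    have hk : w⁻¹ * g ∈ M.comap f ⊓ Z :=
      ⟨by simp [hwg, M.one_mem], Z.mul_mem (Z.inv_mem hwZ) hgZ⟩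
    simpa using mul_mem hw ((le_sup_right : _ ≤ X ⊔ M.comap f ⊓ Z) hk)
  · apply le_antisymm
    · exact sup_le (le_inf le_sup_left hMZ) (le_inf (inf_le_left.trans le_sup_right) inf_le_right)
    rintro g ⟨hg, hgZ⟩
    have hkZ : f.ker ≤ Z := (Subgroup.ker_le_comap f M).trans hMZ
    have hinf : (Y ⊓ Z).map f = Y.map f ⊓ Z.map f :=
      Subgroup.map_inf_of_ker_inf_le f (H := ⊤) le_top le_top (inf_le_left.trans hkZ)
    have h1 : f g ∈ (M.comap f ⊔ Y ⊓ Z).map f := by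
      have hMZ' : M ≤ Z.map f := by rw [← hmc M]; exact Subgroup.map_mono hMZ
      rw [Subgroup.map_sup, hinf, hmc, h.sup_inf' _ _ (Subgroup.map_le_iff_le_comap.2 hY) hMZ'
        (Subgroup.map_le_iff_le_comap.2 hZ)]
      refine ⟨?_, ⟨g, hgZ, rfl⟩⟩
      rw [← hmc M, ← Subgroup.map_sup]
      exact ⟨g, hg, rfl⟩
    obtain ⟨w, hw, hwg⟩ := h1
    have hk : w⁻¹ * g ∈ M.comap f := by simp [Subgroup.mem_comap, hwg, M.one_mem]
    simpa using mul_mem hw ((le_sup_left : _ ≤ M.comap f ⊔ Y ⊓ Z) hk)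

theorem SubmodularIn.le {M H : Subgroup G} (h : SubmodularIn M H) : M ≤ H := by
  induction h with
  | refl => exact le_rfl
  | tail _ h ih => exact ih.trans h.le

theorem SubmodularIn.trans {A B C : Subgroup G} (h : SubmodularIn A B) (h' : SubmodularIn B C) :
    SubmodularIn A C :=
  Relation.ReflTransGen.trans h h'

theorem SubmodularIn.inf {M H : Subgroup G} (h : SubmodularIn M H) (U : Subgroup G) :
    SubmodularIn (M ⊓ U) (H ⊓ U) :=
  Relation.ReflTransGen.lift (· ⊓ U) (fun _ _ h => h.inf U) _ _ h

theorem SubmodularIn.map {M H : Subgroup G} (h : SubmodularIn M H) (f : G →* G') :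
    SubmodularIn (M.map f) (H.map f) :=
  Relation.ReflTransGen.lift (Subgroup.map f) (fun _ _ h => h.map f) _ _ h

theorem SubmodularIn.comap_injective {M H : Subgroup G'} (h : SubmodularIn M H) {f : G →* G'}
    (hf : Function.Injective f) : SubmodularIn (M.comap f) (H.comap f) :=
  Relation.ReflTransGen.lift (Subgroup.comap f) (fun _ _ h => h.comap_injective hf) _ _ h

theorem SubmodularIn.comap_surjective {M H : Subgroup G'} (h : SubmodularIn M H) {f : G →* G'}
    (hf : Function.Surjective f) : SubmodularIn (M.comap f) (H.comap f) :=
  Relation.ReflTransGen.lift (Subgroup.comap f) (fun _ _ h => h.comap_surjective hf) _ _ h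

/-- A proper submodular subgroup lies in a proper modular subgroup. -/
theorem SubmodularIn.exists_modularIn {M H : Subgroup G} (h : SubmodularIn M H) (hne : M ≠ H) :
    ∃ L, M ≤ L ∧ L ≠ H ∧ ModularIn L H := by
  induction h using Relation.ReflTransGen.head_induction_on with
  | refl => exact absurd rfl hne
  | head h1 h2 ih =>
    rename_i A B
    by_cases hB : B = H
    · exact ⟨A, le_rfl, hne, hB ▸ h1⟩
    · obtain ⟨L, hL, h3⟩ := ih hB
      exact ⟨L, h1.le.trans hL, h3⟩

end Basic

/-! ### Comparison of the relative notions with the original definitions -/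

section Defs

variable {G : Type u} [Group G]

theorem isModularSubgroup_iff_modularIn_top {M : Subgroup G} :
    IsModularSubgroup M ↔ ModularIn M ⊤ :=
  ⟨fun h => ⟨le_top, fun X Z hXZ _ => h.1 X Z hXZ, fun Y Z _ hMZ _ => h.2 Y Z hMZ⟩,
    fun h => ⟨fun X Z hXZ => h.sup_inf X Z hXZ le_top,
      fun Y Z hMZ => h.sup_inf' Y Z le_top hMZ le_top⟩⟩

theorem isModularSubgroup_subgroupOf_iff {M H : Subgroup G} (hMH : M ≤ H) :
    IsModularSubgroup (M.subgroupOf H) ↔ ModularIn M H := by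
  rw [isModularSubgroup_iff_modularIn_top]
  constructor
  · intro h
    have := h.map H.subtype
    rwa [Subgroup.map_subgroupOf_eq_of_le hMH, ← MonoidHom.range_eq_map, Subgroup.range_subtype]
      at this
  · intro h
    have := h.comap_injective H.subtype_injective
    rwa [← Subgroup.subgroupOf, ← Subgroup.subgroupOf, Subgroup.subgroupOf_self] at this

theorem isSubmodularSubgroup_iff {H : Subgroup G} :
    IsSubmodularSubgroup H ↔ SubmodularIn H ⊤ := by
  constructor
  · rintro ⟨s, C, rfl, hs, hC⟩
    rw [← hs]
    clear hs
    induction s with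
    | zero => exact Relation.ReflTransGen.refl
    | succ n ih =>
      refine (ih fun i hi => hC i (hi.trans n.lt_succ_self)).tail ?_
      obtain ⟨h1, h2⟩ := hC n n.lt_succ_self
      exact (isModularSubgroup_subgroupOf_iff h1).1 h2
  · intro h
    induction h using Relation.ReflTransGen.head_induction_on with
    | refl => exact ⟨0, fun _ => ⊤, rfl, rfl, fun i hi => absurd hi (Nat.not_lt_zero i)⟩
    | head h1 h2 ih =>
      rename_i A B
      obtain ⟨s, C, h0, hs, hC⟩ := ih
      refine ⟨s + 1, fun i => Nat.casesOn i A C, rfl, hs, fun i hi => ?_⟩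
      cases i with
      | zero =>
        change A ≤ C 0 ∧ IsModularSubgroup (A.subgroupOf (C 0))
        rw [h0]
        exact ⟨h1.le, (isModularSubgroup_subgroupOf_iff h1.le).2 h1⟩
      | succ i => exact hC i (Nat.lt_of_succ_lt_succ hi)

end Defs

/-! ## Groups with submodular Sylow subgroups -/

/-- All Sylow subgroups of `G` are submodular in `G`. -/
def SylowSubmodular (G : Type*) [Group G] : Prop :=
  ∀ (q : ℕ) [Fact q.Prime] (P : Sylow q G), SubmodularIn (P : Subgroup G) ⊤

section Closure

variable {G G₁ G₂ G₃ : Type*} [Group G] [Group G₁] [Group G₂] [Group G₃]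

theorem SylowSubmodular.subgroup (h : SylowSubmodular G) (U : Subgroup G) :
    SylowSubmodular U := by
  intro q _ Q
  obtain ⟨P, hP⟩ := (Q.isPGroup'.map U.subtype).exists_le_sylow
  have hQ : (P : Subgroup G).comap U.subtype = Q :=
    Q.is_maximal' (P.isPGroup'.comap_of_injective _ U.subtype_injective)
      (Subgroup.map_le_iff_le_comap.1 hP)
  have := (h q P).comap_injective U.subtype_injective
  rwa [hQ, Subgroup.comap_top] at this

theorem SylowSubmodular.of_surjective [Finite G] (h : SylowSubmodular G) {f : G →* G₁}
    (hf : Function.Surjective f) : SylowSubmodular G₁ := by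
  intro q _ Q
  obtain ⟨P, rfl⟩ := Sylow.mapSurjective_surjective hf q Q
  have := (h q P).map f
  rwa [Subgroup.map_top_of_surjective f hf] at this

/-- The intersection `W` of the two pulled-back images of `P` is submodular. Modulo `f.ker ⊓ g.ker`
its elements have `q`-power order, so its image under `k` is a `q`-group containing the Sylow
subgroup `k(P)`, hence equal to it. -/
theorem SylowSubmodular.of_ker_inf_ker_le [Finite G] {f : G →* G₁} {g : G →* G₂} {k : G →* G₃}
    (hf : Function.Surjective f) (hg : Function.Surjective g) (hk : Function.Surjective k)
    (hker : f.ker ⊓ g.ker ≤ k.ker) (h₁ : SylowSubmodular G₁) (h₂ : SylowSubmodular G₂) :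
    SylowSubmodular G₃ := by
  intro q _ Q
  obtain ⟨P, rfl⟩ := Sylow.mapSurjective_surjective hk q Q
  set W : Subgroup G :=
    ((P : Subgroup G).map f).comap f ⊓ ((P : Subgroup G).map g).comap g with hW
  have hWs : SubmodularIn W ⊤ := by
    have h3 := (h₁ q (P.mapSurjective hf)).comap_surjective hf
    have h4 := (h₂ q (P.mapSurjective hg)).comap_surjective hg
    have h5 := h3.inf (((P : Subgroup G).map g).comap g)
    rw [Subgroup.comap_top, top_inf_eq] at h5
    exact h5.trans h4
  have hWk : IsPGroup q (W.map k) := by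
    rintro ⟨_, ⟨w, ⟨⟨x, hx, hxw⟩, ⟨y, hy, hyw⟩⟩, rfl⟩⟩
    obtain ⟨m, hm⟩ := P.isPGroup' ⟨x, hx⟩
    obtain ⟨n, hn⟩ := P.isPGroup' ⟨y, hy⟩
    have hm' : x ^ q ^ m = 1 := congrArg Subtype.val hm
    have hn' : y ^ q ^ n = 1 := congrArg Subtype.val hn
    refine ⟨m + n, Subtype.ext ?_⟩
    have : w ^ q ^ (m + n) ∈ k.ker := by
      refine hker (Subgroup.mem_inf.2 ⟨?_, ?_⟩)
      · rw [MonoidHom.mem_ker, map_pow, ← hxw, ← map_pow, pow_add, pow_mul, hm', one_pow, map_one]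
      · rw [MonoidHom.mem_ker, map_pow, ← hyw, ← map_pow, pow_add, mul_comm, pow_mul, hn',
          one_pow, map_one]
    rw [MonoidHom.mem_ker, map_pow] at this
    exact this
  have hPW : (P : Subgroup G) ≤ W :=
    le_inf (Subgroup.le_comap_map f P) (Subgroup.le_comap_map g P)
  have heq : W.map k = P.mapSurjective hk :=
    (P.mapSurjective hk).is_maximal' hWk (Subgroup.map_mono hPW)
  have := hWs.map k
  rwa [Subgroup.map_top_of_surjective k hk, heq] at this

end Closure

/-! ## Submodular `q`-subgroups acting on elementary abelian normal subgroups -/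

section Action

variable {G : Type*} [Group G] {N C D : Subgroup G} [N.Normal]

/-- In a group of `q`-power order generated by `y`, a subgroup without `y ^ q` lies in
`⟨y ^ q⟩`. -/
theorem Subgroup.le_zpowers_pow_of_notMem {q : ℕ} [hq : Fact q.Prime] {y : G} {n : ℕ}
    (hy : y ^ q ^ n = 1) {H : Subgroup G} (hH : H ≤ Subgroup.zpowers y) (hyH : y ^ q ∉ H) :
    H ≤ Subgroup.zpowers (y ^ q) := by
  intro w hw
  obtain ⟨i, rfl⟩ := Subgroup.mem_zpowers_iff.1 (hH hw)
  by_cases hi : (q : ℤ) ∣ i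
  · obtain ⟨j, rfl⟩ := hi
    exact Subgroup.mem_zpowers_iff.2 ⟨j, by rw [zpow_mul, zpow_natCast]⟩
  · exfalso
    have hcop : IsCoprime (i : ℤ) ((q ^ n : ℕ) : ℤ) := by
      push_cast
      exact (((Nat.prime_iff_prime_int.1 hq.out).coprime_iff_not_dvd.2 hi).symm).pow_right
    obtain ⟨a, b, hab⟩ := hcop
    have : y = (y ^ i) ^ a := by
      rw [← zpow_mul]
      have h1 : y ^ (b * ((q ^ n : ℕ) : ℤ)) = 1 := by
        rw [mul_comm, zpow_mul, zpow_natCast, hy, one_zpow]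
      calc y = y ^ (a * i + b * ((q ^ n : ℕ) : ℤ)) := by rw [hab, zpow_one]
        _ = y ^ (i * a) := by rw [zpow_add, h1, mul_one, mul_comm]
    exact hyH (this ▸ H.pow_mem (H.zpow_mem hw a) q)

/-- If `C` is modular in `D` and `N` is abelian, then `C` acts on `(D ∩ N) / (C ∩ N)` by power
automorphisms. -/
theorem ModularIn.exists_conj_eq_zpow (h : ModularIn C D) (hab : ∀ a ∈ N, ∀ b ∈ N, a * b = b * a)
    {a x : G} (ha : a ∈ D ⊓ N) (hx : x ∈ C) :
    ∃ k : ℤ, ∃ c ∈ C ⊓ N, x * a * x⁻¹ = a ^ k * c := by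
  have haN := ha.2
  set X : Subgroup G := Subgroup.zpowers a ⊔ (C ⊓ N)
  have hX : X ≤ D ⊓ N :=
    sup_le (by rwa [Subgroup.zpowers_le]) (inf_le_inf_right _ h.le)
  -- As `X` contains `C ⊓ N`, the modular law says that `(X ⊔ C) ⊓ (D ⊓ N)` is just `X`; the
  -- conjugate of `a` lies in that intersection.
  have h1 := h.sup_inf X (D ⊓ N) hX inf_le_left
  have hxa : x * a * x⁻¹ ∈ X := by
    have h2 : X ⊔ (C ⊓ (D ⊓ N)) ≤ X :=
      sup_le le_rfl (le_sup_of_le_right (inf_le_inf_left _ inf_le_right))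
    apply h2
    rw [h1]
    have hxX : x ∈ X ⊔ C := (le_sup_right : C ≤ X ⊔ C) hx
    have haX : a ∈ X ⊔ C :=
      (le_sup_left.trans le_sup_left : Subgroup.zpowers a ≤ X ⊔ C) (Subgroup.mem_zpowers a)
    have hxD : x ∈ D := h.le hx
    have haD : a ∈ D := ha.1
    exact Subgroup.mem_inf.2 ⟨mul_mem (mul_mem hxX haX) (inv_mem hxX), Subgroup.mem_inf.2
      ⟨mul_mem (mul_mem hxD haD) (inv_mem hxD), ‹N.Normal›.conj_mem a haN x⟩⟩
  have hle : C ⊓ N ≤ Subgroup.normalizer (Subgroup.zpowers a : Set G) := by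
    intro c hc
    refine Subgroup.centralizer_le_normalizer _ (Subgroup.mem_centralizer_iff.2 ?_)
    intro b hb
    obtain ⟨k, rfl⟩ := Subgroup.mem_zpowers_iff.1 hb
    exact hab _ (N.zpow_mem haN k) c hc.2
  have h3 : x * a * x⁻¹ ∈ ((Subgroup.zpowers a ⊔ (C ⊓ N) : Subgroup G) : Set G) := hxa
  rw [Subgroup.coe_mul_of_right_le_normalizer_left _ _ hle] at h3
  obtain ⟨b, hb, c, hc, hbc⟩ := h3
  obtain ⟨k, rfl⟩ := Subgroup.mem_zpowers_iff.1 hb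
  exact ⟨k, c, hc, hbc.symm⟩

theorem ModularIn.commutator_conj_mem (h : ModularIn C D)
    (hab : ∀ a ∈ N, ∀ b ∈ N, a * b = b * a) {a x y : G} (ha : a ∈ D ⊓ N) (hx : x ∈ C)
    (hy : y ∈ C) : (x * y * x⁻¹ * y⁻¹) * a * (x * y * x⁻¹ * y⁻¹)⁻¹ * a⁻¹ ∈ C := by
  -- both `x * y` and `y * x` raise an element to the same power, modulo `C`
  have key : ∀ a ∈ D ⊓ N, (x * y) * a * (x * y)⁻¹ * ((y * x) * a * (y * x)⁻¹)⁻¹ ∈ C := by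
    intro a ha
    obtain ⟨k, c, hc, hk⟩ := h.exists_conj_eq_zpow hab ha hx
    obtain ⟨l, d, hd, hl⟩ := h.exists_conj_eq_zpow hab ha hy
    have hcom : ∀ b ∈ C ⊓ N, ∀ n : ℤ, (a ^ n * b) = b * a ^ n :=
      fun b hb n => hab _ (N.zpow_mem ha.2 n) b hb.2
    have hxy : (x * y) * a * (x * y)⁻¹ = a ^ (k * l) * (c ^ l * (x * d * x⁻¹)) := by
      calc (x * y) * a * (x * y)⁻¹ = x * (y * a * y⁻¹) * x⁻¹ := by group
        _ = (x * a * x⁻¹) ^ l * (x * d * x⁻¹) := by rw [hl, conj_zpow]; group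
        _ = _ := by
          have : Commute (a ^ k) c := hcom c hc k
          rw [hk, this.mul_zpow, ← zpow_mul, mul_assoc]
    have hyx : (y * x) * a * (y * x)⁻¹ = a ^ (k * l) * (d ^ k * (y * c * y⁻¹)) := by
      calc (y * x) * a * (y * x)⁻¹ = y * (x * a * x⁻¹) * y⁻¹ := by group
        _ = (y * a * y⁻¹) ^ k * (y * c * y⁻¹) := by rw [hk, conj_zpow]; group
        _ = _ := by
          have : Commute (a ^ l) d := hcom d hd l
          rw [hl, this.mul_zpow, ← zpow_mul, mul_assoc, mul_comm l k]
    have e1 : c ^ l * (x * d * x⁻¹) ∈ C ⊓ N := Subgroup.mem_inf.2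
      ⟨C.mul_mem (C.zpow_mem hc.1 l) (C.mul_mem (C.mul_mem hx hd.1) (C.inv_mem hx)),
        N.mul_mem (N.zpow_mem hc.2 l) (‹N.Normal›.conj_mem d hd.2 x)⟩
    have e2 : d ^ k * (y * c * y⁻¹) ∈ C ⊓ N := Subgroup.mem_inf.2
      ⟨C.mul_mem (C.zpow_mem hd.1 k) (C.mul_mem (C.mul_mem hy hc.1) (C.inv_mem hy)),
        N.mul_mem (N.zpow_mem hd.2 k) (‹N.Normal›.conj_mem c hc.2 y)⟩
    rw [hxy, hyx, hcom _ e1, hcom _ e2]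
    have : ∀ u v w : G, u * v * (w * v)⁻¹ = u * w⁻¹ := fun u v w => by group
    rw [this]
    exact C.mul_mem e1.1 (C.inv_mem e2.1)
  have hyx : y * x ∈ D := D.mul_mem (h.le hy) (h.le hx)
  -- With this conjugate of `a` in `key`, conjugation by `y * x` returns `a`, and conjugation by `x
  -- * y` becomes conjugation of `a` by the commutator.
  have ha' : (y * x)⁻¹ * a * (y * x) ∈ D ⊓ N := by
    refine Subgroup.mem_inf.2 ⟨D.mul_mem (D.mul_mem (D.inv_mem hyx) ha.1) hyx, ?_⟩
    simpa using ‹N.Normal›.conj_mem a ha.2 (y * x)⁻¹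
  have := key _ ha'
  convert this using 1
  group

/-- One exponent `k` serves all powers of `x`, so arithmetic of `k ^ n` modulo `p` decides which
powers act trivially. -/
theorem ModularIn.exists_pow_conj_eq_zpow (h : ModularIn C D)
    (hab : ∀ a ∈ N, ∀ b ∈ N, a * b = b * a) {a x : G} (ha : a ∈ D ⊓ N) (hx : x ∈ C) :
    ∃ k : ℤ, ∀ n : ℕ, ∃ c ∈ C ⊓ N, x ^ n * a * (x ^ n)⁻¹ = a ^ (k ^ n) * c := by
  obtain ⟨k, c, hc, hk⟩ := h.exists_conj_eq_zpow hab ha hx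
  refine ⟨k, fun n => ?_⟩
  induction n with
  | zero => exact ⟨1, one_mem _, by simp⟩
  | succ n ih =>
    obtain ⟨d, hd, hn⟩ := ih
    refine ⟨c ^ (k ^ n) * (x * d * x⁻¹), Subgroup.mem_inf.2
      ⟨C.mul_mem (C.zpow_mem hc.1 _) (C.mul_mem (C.mul_mem hx hd.1) (C.inv_mem hx)),
        N.mul_mem (N.zpow_mem hc.2 _) (‹N.Normal›.conj_mem d hd.2 x)⟩, ?_⟩
    have hcomm : Commute (a ^ k) c := hab _ (N.zpow_mem ha.2 k) c hc.2
    calc x ^ (n + 1) * a * (x ^ (n + 1))⁻¹ = x * (x ^ n * a * (x ^ n)⁻¹) * x⁻¹ := by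
          rw [pow_succ']; group
      _ = (x * a * x⁻¹) ^ (k ^ n) * (x * d * x⁻¹) := by rw [hn, conj_zpow]; group
      _ = _ := by rw [hk, hcomm.mul_zpow, ← zpow_mul, mul_assoc, pow_succ' k n]

theorem zpow_eq_self_of_modEq {p : ℕ} {a : G} (ha : a ^ p = 1) {k : ℤ} (hk : k ≡ 1 [ZMOD p]) :
    a ^ k = a := by
  obtain ⟨m, hm⟩ := hk.symm.dvd
  rw [show k = 1 + p * m by linarith, zpow_add, zpow_mul, zpow_natCast, ha, one_zpow, zpow_one,
    mul_one]

/-- Fermat's little theorem for the exponent `k`. If `p` divides `k`, then `x` conjugates `a` into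
`C`, so `a` already lies in `C`. -/
theorem ModularIn.pow_sub_one_conj_mem {p : ℕ} (hp : p.Prime) (h : ModularIn C D)
    (hab : ∀ a ∈ N, ∀ b ∈ N, a * b = b * a) (hexp : ∀ a ∈ N, a ^ p = 1) {a x : G}
    (ha : a ∈ D ⊓ N) (hx : x ∈ C) :
    x ^ (p - 1) * a * (x ^ (p - 1))⁻¹ * a⁻¹ ∈ C := by
  obtain ⟨k, hk⟩ := h.exists_pow_conj_eq_zpow hab ha hx
  by_cases hpk : (p : ℤ) ∣ k
  · have haC : a ∈ C := by
      obtain ⟨c, hc, h1⟩ := hk 1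
      obtain ⟨m, rfl⟩ := hpk
      rw [pow_one, pow_one, zpow_mul, zpow_natCast, hexp a ha.2, one_zpow, one_mul] at h1
      rw [show a = x⁻¹ * (x * a * x⁻¹) * x by group, h1]
      exact C.mul_mem (C.mul_mem (C.inv_mem hx) hc.1) hx
    exact C.mul_mem (C.mul_mem (C.mul_mem (C.pow_mem hx _) haC) (C.inv_mem (C.pow_mem hx _)))
      (C.inv_mem haC)
  · obtain ⟨c, hc, h1⟩ := hk (p - 1)
    have hcop : IsCoprime k (p : ℤ) :=
      ((Nat.prime_iff_prime_int.1 hp).coprime_iff_not_dvd.2 hpk).symm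
    rw [h1, zpow_eq_self_of_modEq (hexp a ha.2) (Int.ModEq.pow_card_sub_one_eq_one hp hcop),
      hab a ha.2 c hc.2, mul_inv_cancel_right]
    exact hc.1

/-- Let `y` be the conjugate of `x` by `a`; it suffices that `y ^ q ∈ C`. Otherwise `C ⊓ ⟨y⟩ ≤ ⟨y ^
q⟩`, and the modular law gives `(⟨y ^ q⟩ ⊔ C) ⊓ ⟨y⟩ = ⟨y ^ q⟩`. But `⟨y ^ q⟩ ⊔ C` contains `a ^ (k ^
q - 1)`. If `p` does not divide `k ^ q - 1`, it contains `a`, hence `y`, so `y ∈ ⟨y ^ q⟩` and `y =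
1`. If `p` divides it, then `y ^ q ∈ C` directly. -/
theorem ModularIn.pow_conj_mem {p q : ℕ} [hq : Fact q.Prime] (hp : p.Prime) (h : ModularIn C D)
    (hab : ∀ a ∈ N, ∀ b ∈ N, a * b = b * a) (hexp : ∀ a ∈ N, a ^ p = 1) {a x : G}
    (ha : a ∈ D ⊓ N) (hx : x ∈ C) {n : ℕ} (hxn : x ^ q ^ n = 1) :
    x ^ q * a * (x ^ q)⁻¹ * a⁻¹ ∈ C := by
  obtain ⟨k, hk⟩ := h.exists_pow_conj_eq_zpow hab ha hx
  obtain ⟨c, hc, h1⟩ := hk q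
  set y := a * x * a⁻¹ with hy
  have hyq : y ^ q = a * x ^ q * a⁻¹ := conj_pow
  have hyn : y ^ q ^ n = 1 := by rw [hy, conj_pow, hxn]; group
  have haD : a ∈ D := ha.1
  have hyD : y ∈ D := D.mul_mem (D.mul_mem haD (h.le hx)) (D.inv_mem haD)
  have hb : x ^ q * a * (x ^ q)⁻¹ * a⁻¹ = x ^ q * (y ^ q)⁻¹ := by rw [hyq]; group
  rw [hb]
  suffices hyC : y ^ q ∈ C from C.mul_mem (C.pow_mem hx q) (C.inv_mem hyC)
  by_contra hyC
  set X := Subgroup.zpowers (y ^ q)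
  have hXZ : X ≤ Subgroup.zpowers y := by
    rw [Subgroup.zpowers_le]; exact Subgroup.npow_mem_zpowers y q
  have h2 := h.sup_inf X (Subgroup.zpowers y) hXZ (by rwa [Subgroup.zpowers_le])
  have h3 : C ⊓ Subgroup.zpowers y ≤ X :=
    Subgroup.le_zpowers_pow_of_notMem hyn inf_le_right fun h => hyC h.1
  rw [sup_eq_left.2 h3] at h2
  have hyX' : y ^ q ∈ X ⊔ C := (le_sup_left : X ≤ X ⊔ C) (Subgroup.mem_zpowers _)
  have hC' : C ≤ X ⊔ C := le_sup_right
  have hb' : a ^ (k ^ q - 1) = x ^ q * (y ^ q)⁻¹ * c⁻¹ := by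
    rw [← hb, h1, zpow_sub_one]
    have h4 : Commute (a ^ (k ^ q)) c := hab _ (N.zpow_mem ha.2 _) c hc.2
    have h5 : Commute a⁻¹ c⁻¹ := Commute.inv_inv (hab a ha.2 c hc.2)
    rw [mul_assoc _ a⁻¹ c⁻¹, h5.eq]
    group
  have hpow : a ^ (k ^ q - 1) ∈ X ⊔ C := by
    rw [hb']
    exact mul_mem (mul_mem (hC' (C.pow_mem hx q)) (inv_mem hyX')) (inv_mem (hC' hc.1))
  have hndvd : ¬ (p : ℤ) ∣ k ^ q - 1 := by
    rintro ⟨m, hm⟩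
    rw [hm, zpow_mul, zpow_natCast, hexp a ha.2, one_zpow] at hb'
    apply hyC
    have : y ^ q = c⁻¹ * x ^ q := by
      have h6 : x ^ q * (y ^ q)⁻¹ = c := by
        rw [← mul_inv_eq_one]; exact hb'.symm
      rw [← h6]; group
    rw [this]
    exact C.mul_mem (C.inv_mem hc.1) (C.pow_mem hx q)
  obtain ⟨u, v, huv⟩ := ((Nat.prime_iff_prime_int.1 hp).coprime_iff_not_dvd.2 hndvd)
  have haX : a ∈ X ⊔ C := by
    have : a = (a ^ (k ^ q - 1)) ^ v := by
      rw [← zpow_mul, mul_comm]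
      refine (zpow_eq_self_of_modEq (hexp a ha.2) ?_).symm
      exact (Int.modEq_iff_dvd.2 ⟨u, by linarith⟩)
    rw [this]
    exact zpow_mem hpow v
  have hyX : y ∈ X := by
    have : y ∈ (X ⊔ C) ⊓ Subgroup.zpowers y :=
      Subgroup.mem_inf.2 ⟨mul_mem (mul_mem haX (hC' hx)) (inv_mem haX), Subgroup.mem_zpowers y⟩
    rwa [← h2] at this
  obtain ⟨i, hi⟩ := Subgroup.mem_zpowers_iff.1 hyX
  have hy1 : y = 1 := by
    have h7 : y ^ ((q : ℤ) * i - 1) = 1 := by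
      rw [zpow_sub_one, zpow_mul, zpow_natCast, hi, mul_inv_cancel]
    have hcop : IsCoprime ((q : ℤ) * i - 1) ((q : ℤ) ^ n) :=
      IsCoprime.pow_right ⟨-1, i, by ring⟩
    obtain ⟨s, t, hst⟩ := hcop
    have h8 : y ^ ((q : ℤ) ^ n) = 1 := by exact_mod_cast hyn
    calc y = y ^ (s * ((q : ℤ) * i - 1) + t * (q : ℤ) ^ n) := by rw [hst, zpow_one]
      _ = 1 := by rw [zpow_add, mul_comm s, mul_comm t, zpow_mul, zpow_mul, h7, h8]; simp
  exact hyC (by rw [hy1, one_pow]; exact C.one_mem)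

theorem eq_one_of_pow_prime_pow {p q n : ℕ} (hp : p.Prime) (hq : q.Prime) (hpq : p ≠ q) {a : G}
    (h : a ^ p = 1) (h' : a ^ q ^ n = 1) : a = 1 := by
  have h1 : Nat.Coprime p (q ^ n) := ((Nat.coprime_primes hp hq).2 hpq).pow_right n
  have := Nat.dvd_gcd (orderOf_dvd_of_pow_eq_one h) (orderOf_dvd_of_pow_eq_one h')
  rw [h1.gcd_eq_one, Nat.dvd_one, orderOf_eq_one_iff] at this
  exact this

/-- A `q`-element that acts trivially on the factors which a chain of subgroups induces on an
abelian group of exponent `p ≠ q` centralizes that group. -/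
theorem SubmodularIn.commute_of_forall_conj_mem {p q : ℕ} (hp : p.Prime) (hq : q.Prime)
    (hpq : p ≠ q) {Q T : Subgroup G} (h : SubmodularIn Q T) (hNT : N ≤ T) (hQ : IsPGroup q Q)
    (hexp : ∀ a ∈ N, a ^ p = 1) {z : G} (hz : z ∈ Q)
    (hstep : ∀ C D : Subgroup G, ModularIn C D → Q ≤ C → ∀ a ∈ D ⊓ N,
      z * a * z⁻¹ * a⁻¹ ∈ C) : ∀ a ∈ N, z * a = a * z := by
  obtain ⟨n, hn⟩ := hQ ⟨z, hz⟩
  have hzn : z ^ q ^ n = 1 := congrArg Subtype.val hn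
  suffices H : Q ≤ T ∧ ∀ a ∈ T ⊓ N, z * a = a * z from fun a ha => H.2 a ⟨hNT ha, ha⟩
  clear hNT
  induction h with
  | refl =>
    refine ⟨le_rfl, fun a ha => ?_⟩
    obtain ⟨m, hm⟩ := hQ ⟨a, ha.1⟩
    have : a = 1 := eq_one_of_pow_prime_pow hp hq hpq (hexp a ha.2) (congrArg Subtype.val hm)
    rw [this, mul_one, one_mul]
  | tail h1 h2 ih =>
    obtain ⟨hQC, ih⟩ := ih
    refine ⟨hQC.trans h2.le, fun a ha => ?_⟩
    set c := z * a * z⁻¹ * a⁻¹ with hc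
    have hcC := hstep _ _ h2 hQC a ha
    have hcN : c ∈ N := N.mul_mem (‹N.Normal›.conj_mem a ha.2 z) (N.inv_mem ha.2)
    have hzc : Commute z c := ih c (Subgroup.mem_inf.2 ⟨hcC, hcN⟩)
    -- By induction `z` commutes with `c`, so iterated conjugation multiplies `a` by powers of `c`.
    -- At exponent `q ^ n` this gives `c ^ q ^ n = 1`, while `c ^ p = 1`.
    have hpow : ∀ k : ℕ, z ^ k * a * (z ^ k)⁻¹ = c ^ k * a := by
      intro k
      induction k with
      | zero => simp
      | succ k ih =>
        calc z ^ (k + 1) * a * (z ^ (k + 1))⁻¹ = z * (z ^ k * a * (z ^ k)⁻¹) * z⁻¹ := by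
              rw [pow_succ']; group
          _ = c ^ k * (z * a * z⁻¹) := by
              rw [ih, ← mul_assoc, (hzc.pow_right k).eq]; group
          _ = c ^ (k + 1) * a := by rw [hc, pow_succ]; group
    have h3 := hpow (q ^ n)
    rw [hzn, one_mul, inv_one, mul_one, right_eq_mul] at h3
    have hc1 : c = 1 := eq_one_of_pow_prime_pow hp hq hpq (hexp c hcN) h3
    rw [hc, mul_inv_eq_one, mul_inv_eq_iff_eq_mul] at hc1
    exact hc1

section

variable {p q : ℕ} [Fact q.Prime] {Q T : Subgroup G}

/-- This and the next two facts say together that `Q / C_Q(N)` is abelian of exponent dividing `p -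
1` and `q`. -/
theorem SubmodularIn.commute_commutator (hp : p.Prime) (hpq : p ≠ q) (h : SubmodularIn Q T)
    (hNT : N ≤ T) (hQ : IsPGroup q Q) (hab : ∀ a ∈ N, ∀ b ∈ N, a * b = b * a)
    (hexp : ∀ a ∈ N, a ^ p = 1) {x y : G} (hx : x ∈ Q) (hy : y ∈ Q) :
    ∀ a ∈ N, (x * y * x⁻¹ * y⁻¹) * a = a * (x * y * x⁻¹ * y⁻¹) :=
  h.commute_of_forall_conj_mem hp Fact.out hpq hNT hQ hexp
    (Q.mul_mem (Q.mul_mem (Q.mul_mem hx hy) (Q.inv_mem hx)) (Q.inv_mem hy))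
    fun _ _ hCD hQC _ ha => hCD.commutator_conj_mem hab ha (hQC hx) (hQC hy)

theorem SubmodularIn.commute_pow_sub_one (hp : p.Prime) (hpq : p ≠ q) (h : SubmodularIn Q T)
    (hNT : N ≤ T) (hQ : IsPGroup q Q) (hab : ∀ a ∈ N, ∀ b ∈ N, a * b = b * a)
    (hexp : ∀ a ∈ N, a ^ p = 1) {x : G} (hx : x ∈ Q) :
    ∀ a ∈ N, x ^ (p - 1) * a = a * x ^ (p - 1) :=
  h.commute_of_forall_conj_mem hp Fact.out hpq hNT hQ hexp (Q.pow_mem hx _)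
    fun _ _ hCD hQC _ ha => hCD.pow_sub_one_conj_mem hp hab hexp ha (hQC hx)

theorem SubmodularIn.commute_pow (hp : p.Prime) (hpq : p ≠ q) (h : SubmodularIn Q T)
    (hNT : N ≤ T) (hQ : IsPGroup q Q) (hab : ∀ a ∈ N, ∀ b ∈ N, a * b = b * a)
    (hexp : ∀ a ∈ N, a ^ p = 1) {x : G} (hx : x ∈ Q) :
    ∀ a ∈ N, x ^ q * a = a * x ^ q := by
  obtain ⟨n, hn⟩ := hQ ⟨x, hx⟩
  exact h.commute_of_forall_conj_mem hp Fact.out hpq hNT hQ hexp (Q.pow_mem hx _)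
    fun _ _ hCD hQC _ ha => hCD.pow_conj_mem hp hab hexp ha (hQC hx) (congrArg Subtype.val hn)

end

end Action

/-! ## Simple groups with submodular Sylow subgroups -/

section Simple

open Subgroup

variable {G : Type*} [Group G] [Finite G]

/-- In a finite `s`-group, a proper subgroup which together with any further element generates the
whole group is normal. -/
theorem IsPGroup.le_normalizer_of_zpowers_sup {s : ℕ} [Fact s.Prime] {S D : Subgroup G}
    (hS : IsPGroup s S) (hDS : D < S) (h : ∀ y ∈ S, y ∉ D → zpowers y ⊔ D = S) :
    S ≤ normalizer (D : Set G) := by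
  have : Group.IsNilpotent S := hS.isNilpotent
  have hlt : D.subgroupOf S < ⊤ := by
    rw [lt_top_iff_ne_top, Ne, subgroupOf_eq_top]
    exact not_le_of_gt hDS
  -- Normalizers grow in nilpotent groups, so some `y` in `S` outside `D` normalizes `D`; together
  -- with `D` it generates `S`.
  obtain ⟨y, hyn, hyD⟩ := SetLike.exists_of_lt (Group.normalizerCondition_of_isNilpotent _ hlt)
  have hy : (y : G) ∈ normalizer (D : Set G) := by
    rw [mem_normalizer_iff] at hyn ⊢
    intro n
    constructor
    · intro hn
      exact (hyn ⟨n, hDS.le hn⟩).1 hn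
    · intro hn
      have hnS : n ∈ S := by
        have := S.mul_mem (S.mul_mem (S.inv_mem y.2) (hDS.le hn)) y.2
        simpa [mul_assoc] using this
      exact (hyn ⟨n, hnS⟩).2 hn
  rw [← h y y.2 hyD]
  exact sup_le (by rwa [zpowers_le]) le_normalizer

variable {p : ℕ} [hp : Fact p.Prime]

/-- The properties of a finite simple group with submodular Sylow subgroups, all of whose proper
subgroups have normal Sylow `p`-subgroups, which are used to show that there is no such group. -/
structure SimpleSylowConfiguration (G : Type*) [Group G] (p : ℕ) : Prop where
  eq_bot_or_eq_top : ∀ N : Subgroup G, N.Normal → N = ⊥ ∨ N = ⊤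
  not_normal : ∀ P : Sylow p G, ¬ (P : Subgroup G).Normal
  le_normalizer : ∀ U : Subgroup G, U ≠ ⊤ → ∀ P : Sylow p G, (P : Subgroup G) ≤ U →
    U ≤ normalizer ((P : Subgroup G) : Set G)
  submodular : SylowSubmodular G

namespace SimpleSylowConfiguration

set_option linter.unusedSectionVars false

variable (h : SimpleSylowConfiguration G p) {P Q : Sylow p G}

include h

theorem ne_bot (P : Sylow p G) : (P : Subgroup G) ≠ ⊥ := fun hb =>
  h.not_normal P (hb ▸ normal_bot)

theorem ne_top (P : Sylow p G) : (P : Subgroup G) ≠ ⊤ := fun hb =>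
  h.not_normal P (hb ▸ normal_top)

theorem normalizer_ne_top (P : Sylow p G) : normalizer ((P : Subgroup G) : Set G) ≠ ⊤ := fun hb =>
  h.not_normal P (normalizer_eq_top_iff.1 hb)

omit [Finite G] hp h in
theorem mem_of_mem_normalizer (P : Sylow p G) {y : G} (hy : y ∈ normalizer ((P : Subgroup G) : Set G))
    {n : ℕ} (hyn : y ^ p ^ n = 1) : y ∈ P := by
  have h1 : IsPGroup p (zpowers y) := by
    rintro ⟨_, ⟨k, rfl⟩⟩
    refine ⟨n, Subtype.ext ?_⟩
    change (y ^ k) ^ p ^ n = 1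
    rw [← zpow_natCast, ← zpow_mul, mul_comm, zpow_mul, zpow_natCast, hyn, one_zpow]
  have h2 := h1.inf_normalizer_sylow P
  have h3 : y ∈ zpowers y ⊓ normalizer ((P : Subgroup G) : Set G) := mem_inf.2 ⟨mem_zpowers y, hy⟩
  exact (mem_inf.1 (h2 ▸ h3)).2

omit [Finite G] hp h in
theorem exists_pow_eq_one (P : Sylow p G) {y : G} (hy : y ∈ P) : ∃ n, y ^ p ^ n = 1 := by
  obtain ⟨n, hn⟩ := P.isPGroup' ⟨y, hy⟩
  exact ⟨n, congrArg Subtype.val hn⟩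

theorem sup_eq_top (hPQ : P ≠ Q) : (P : Subgroup G) ⊔ Q = ⊤ := by
  by_contra hne
  apply hPQ
  have h1 : (Q : Subgroup G) ≤ P := by
    intro y hy
    obtain ⟨n, hn⟩ := exists_pow_eq_one Q hy
    exact mem_of_mem_normalizer P (h.le_normalizer _ hne P le_sup_left
      ((le_sup_right : (Q : Subgroup G) ≤ (P : Subgroup G) ⊔ Q) hy)) hn
  exact Sylow.ext (Q.is_maximal' P.isPGroup' h1)

theorem exists_ne (P : Sylow p G) : ∃ Q : Sylow p G, P ≠ Q := by
  by_contra! hall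
  have : Subsingleton (Sylow p G) := ⟨fun A B => (hall A).symm.trans (hall B)⟩
  exact h.not_normal P (Sylow.normal_of_subsingleton P)

theorem exists_modularIn {s : ℕ} [Fact s.Prime] (S : Sylow s G) (hS : (S : Subgroup G) ≠ ⊤) :
    ∃ M : Subgroup G, (S : Subgroup G) ≤ M ∧ M ≠ ⊤ ∧ ModularIn M ⊤ :=
  (h.submodular s S).exists_modularIn hS

/-- A proper modular `M ≥ P` normalizes `P`, so `M ⊓ Q = P ⊓ Q`; and `y` together with `M` generates
`G`, since `y` does not normalize `P`. The modular law then computes the join. -/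
theorem zpowers_sup_inf (P Q : Sylow p G) {y : G} (hyQ : y ∈ Q) (hyP : y ∉ P) :
    zpowers y ⊔ ((P : Subgroup G) ⊓ Q) = Q := by
  obtain ⟨M, hPM, hM, hmod⟩ := h.exists_modularIn P (h.ne_top P)
  have hMP := h.le_normalizer M hM P hPM
  have hyQ' : zpowers y ≤ Q := by rwa [zpowers_le]
  have h1 : M ⊓ Q = (P : Subgroup G) ⊓ Q := by
    apply le_antisymm
    · intro x hx
      obtain ⟨n, hn⟩ := exists_pow_eq_one Q hx.2
      exact mem_inf.2 ⟨mem_of_mem_normalizer P (hMP hx.1) hn, hx.2⟩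
    · exact inf_le_inf_right _ hPM
  have h2 : zpowers y ⊔ M = ⊤ := by
    by_contra hne
    obtain ⟨n, hn⟩ := exists_pow_eq_one Q hyQ
    exact hyP (mem_of_mem_normalizer P (h.le_normalizer _ hne P (hPM.trans le_sup_right)
      ((le_sup_left : zpowers y ≤ zpowers y ⊔ M) (mem_zpowers y))) hn)
  have h3 := hmod.sup_inf _ _ hyQ' le_top
  rwa [h1, h2, top_inf_eq] at h3

theorem le_normalizer_inf (hPQ : P ≠ Q) :
    (Q : Subgroup G) ≤ normalizer (((P : Subgroup G) ⊓ Q : Subgroup G) : Set G) := by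
  refine Q.isPGroup'.le_normalizer_of_zpowers_sup (lt_of_le_of_ne inf_le_right fun heq => ?_) ?_
  · exact hPQ (Sylow.ext (Q.is_maximal' P.isPGroup' (inf_eq_right.1 heq)))
  · intro y hy hyn
    exact h.zpowers_sup_inf P Q hy fun hyP => hyn (mem_inf.2 ⟨hyP, hy⟩)

/-- The intersection is normalized by `P` and by `Q`, which generate `G`, so simplicity applies. -/
theorem inf_eq_bot (hPQ : P ≠ Q) : (P : Subgroup G) ⊓ Q = ⊥ := by
  have h1 : normalizer (((P : Subgroup G) ⊓ Q : Subgroup G) : Set G) = ⊤ := by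
    rw [eq_top_iff, ← h.sup_eq_top hPQ]
    refine sup_le ?_ (h.le_normalizer_inf hPQ)
    have := h.le_normalizer_inf hPQ.symm
    rwa [inf_comm] at this
  rcases h.eq_bot_or_eq_top _ (normalizer_eq_top_iff.1 h1) with h2 | h2
  · exact h2
  · exact absurd (top_le_iff.1 (h2 ▸ inf_le_left)) (h.ne_top P)

/-- An element of order `p` in `P` lies outside another Sylow subgroup `Q`; as `P ⊓ Q` is trivial,
it generates `P` by `zpowers_sup_inf`. -/
theorem card_eq (P : Sylow p G) : Nat.card P = p := by
  obtain ⟨Q, hQ⟩ := h.exists_ne P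
  have hdvd : p ∣ Nat.card P := by
    rcases P.isPGroup'.card_eq_or_dvd with h1 | h1
    · exact absurd (card_eq_one.1 h1) (h.ne_bot P)
    · exact h1
  obtain ⟨⟨y, hy⟩, hord⟩ := exists_prime_orderOf_dvd_card' p hdvd
  have hord' : orderOf y = p := by rwa [orderOf_mk] at hord
  have hyQ : y ∉ Q := fun hyQ => by
    have : y ∈ (P : Subgroup G) ⊓ Q := mem_inf.2 ⟨hy, hyQ⟩
    rw [h.inf_eq_bot hQ, mem_bot] at this
    rw [this, orderOf_one] at hord'
    exact hp.out.one_lt.ne hord'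
  have h1 := h.zpowers_sup_inf Q P hy hyQ
  rw [h.inf_eq_bot hQ.symm, sup_bot_eq] at h1
  exact (congrArg (fun H : Subgroup G => Nat.card H) h1).symm.trans
    ((Nat.card_zpowers y).trans hord')

/-- The proper modular subgroup `M ≥ P` is the normalizer itself: in the second identity with `Z`
the normalizer, `Q ⊓ Z` is trivial and `M ⊔ Q` is everything. -/
theorem modularIn_normalizer (P : Sylow p G) : ModularIn (normalizer ((P : Subgroup G) : Set G)) ⊤ := by
  obtain ⟨M, hPM, hM, hmod⟩ := h.exists_modularIn P (h.ne_top P)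
  obtain ⟨Q, hQ⟩ := h.exists_ne P
  have hMP := h.le_normalizer M hM P hPM
  have h1 := hmod.sup_inf' Q _ le_top hMP le_top
  have h2 : (Q : Subgroup G) ⊓ normalizer ((P : Subgroup G) : Set G) = ⊥ :=
    (Q.isPGroup'.inf_normalizer_sylow P).trans (h.inf_eq_bot hQ.symm)
  have h3 : M ⊔ Q = ⊤ := top_le_iff.1 (h.sup_eq_top hQ ▸ sup_le_sup_right hPM _)
  rw [h2, sup_bot_eq, h3, top_inf_eq] at h1
  rwa [← h1]

theorem sup_normalizer {X : Subgroup G} (P : Sylow p G) (hX : ¬ X ≤ normalizer ((P : Subgroup G) : Set G)) :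
    X ⊔ normalizer ((P : Subgroup G) : Set G) = ⊤ := by
  by_contra hne
  exact hX (le_sup_left.trans
    (h.le_normalizer _ hne P (P.le_normalizer.trans le_sup_right)))

theorem sup_inf_normalizer {X Z : Subgroup G} (P : Sylow p G) (hXZ : X ≤ Z)
    (hX : ¬ X ≤ normalizer ((P : Subgroup G) : Set G)) : X ⊔ (normalizer ((P : Subgroup G) : Set G) ⊓ Z) = Z := by
  rw [(h.modularIn_normalizer P).sup_inf X Z hXZ le_top, h.sup_normalizer P hX, top_inf_eq]

/-- These elements form the kernel of the conjugation action on the Sylow `p`-subgroups, a proper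
normal subgroup. -/
theorem eq_one_of_forall_mem_normalizer {c : G}
    (hc : ∀ Q : Sylow p G, c ∈ normalizer ((Q : Subgroup G) : Set G)) : c = 1 := by
  have hmem : ∀ g, g ∈ (MulAction.toPermHom G (Sylow p G)).ker ↔
      ∀ Q : Sylow p G, g ∈ normalizer ((Q : Subgroup G) : Set G) := by
    intro g
    simp only [MonoidHom.mem_ker, Equiv.ext_iff, MulAction.toPermHom_apply, MulAction.toPerm_apply,
      Equiv.Perm.coe_one, id_eq]
    exact forall_congr' fun Q => Sylow.smul_eq_iff_mem_normalizer
  have hcK := (hmem c).2 hc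
  rcases h.eq_bot_or_eq_top _ (MonoidHom.normal_ker (MulAction.toPermHom G (Sylow p G))) with
    h1 | h1
  · rwa [h1, mem_bot] at hcK
  · exfalso
    refine h.normalizer_ne_top (default : Sylow p G) (eq_top_iff.2 fun g _ => ?_)
    exact (hmem g).1 (h1 ▸ mem_top g) _

theorem not_dvd_orderOf (hPQ : P ≠ Q) {k : G} (hkP : k ∈ normalizer ((P : Subgroup G) : Set G))
    (hkQ : k ∈ normalizer ((Q : Subgroup G) : Set G)) : ¬ p ∣ orderOf k := by
  intro hdvd
  have h0 : orderOf k ≠ 0 := (orderOf_pos k).ne'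
  set y := k ^ (orderOf k / p)
  have hy : orderOf y = p := orderOf_pow_orderOf_div h0 hdvd
  have hyp : y ^ p ^ 1 = 1 := by rw [pow_one, ← hy, pow_orderOf_eq_one]
  have : y ∈ (P : Subgroup G) ⊓ Q := mem_inf.2
    ⟨mem_of_mem_normalizer P (pow_mem hkP _) hyp, mem_of_mem_normalizer Q (pow_mem hkQ _) hyp⟩
  rw [h.inf_eq_bot hPQ, mem_bot] at this
  rw [this, orderOf_one] at hy
  exact hp.out.one_lt.ne hy

/-- The factorization `N(P) = P (N(P) ⊓ N(Q))` is the modular law for `N(Q)` between `P` and `N(P)`.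
-/
theorem exists_eq_mul (hPQ : P ≠ Q) {y : G} (hy : y ∈ normalizer ((P : Subgroup G) : Set G)) :
    ∃ u ∈ P, ∃ k, k ∈ normalizer ((P : Subgroup G) : Set G) ∧ k ∈ normalizer ((Q : Subgroup G) : Set G) ∧ y = u * k := by
  have hPN : ¬ (P : Subgroup G) ≤ normalizer ((Q : Subgroup G) : Set G) := by
    intro hle
    have h0 : (P : Subgroup G) ⊓ normalizer ((Q : Subgroup G) : Set G) = ⊥ :=
      (P.isPGroup'.inf_normalizer_sylow Q).trans (h.inf_eq_bot hPQ)
    exact h.ne_bot P (inf_eq_left.2 hle ▸ h0)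
  have h1 := h.sup_inf_normalizer Q P.le_normalizer hPN
  have h2 : y ∈ (((P : Subgroup G) ⊔ (normalizer ((Q : Subgroup G) : Set G) ⊓ normalizer ((P : Subgroup G) : Set G)) :
      Subgroup G) : Set G) := by rw [h1]; exact hy
  rw [coe_mul_of_right_le_normalizer_left _ _ inf_le_right] at h2
  obtain ⟨u, hu, k, hk, rfl⟩ := h2
  exact ⟨u, hu, k, hk.2, hk.1, rfl⟩

theorem pow_eq_one (P : Sylow p G) {u : G} (hu : u ∈ P) : u ^ p = 1 := by
  have : (⟨u, hu⟩ : P) ^ Nat.card P = 1 := pow_card_eq_one'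
  rw [h.card_eq P] at this
  exact congrArg Subtype.val this

/-- Write `c = u * k` as in `exists_eq_mul`. The factors commute, `c` and `k` have order prime to
`p`, and `u` is a `p`-element, so `u = 1` and `c` normalizes `Q`. As `Q` is arbitrary, `c = 1`. -/
theorem eq_one_of_commute (P : Sylow p G) {c : G} (hc : ∀ u ∈ P, c * u = u * c)
    (hcp : ¬ p ∣ orderOf c) : c = 1 := by
  have hcP : c ∈ normalizer ((P : Subgroup G) : Set G) := centralizer_le_normalizer _
    (mem_centralizer_iff.2 fun u hu => (hc u hu).symm)
  refine h.eq_one_of_forall_mem_normalizer fun Q => ?_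
  by_cases hPQ : P = Q
  · rwa [← hPQ]
  obtain ⟨u, hu, k, hkP, hkQ, hk⟩ := h.exists_eq_mul hPQ hcP
  have hkp := h.not_dvd_orderOf hPQ hkP hkQ
  have hcu : Commute u c := (hc u hu).symm
  have hk' : k = u⁻¹ * c := by rw [hk]; group
  have huk : Commute u k := by
    rw [hk']; exact ((Commute.refl u).inv_right).mul_right hcu
  have h1 : u ^ (orderOf c * orderOf k) = 1 := by
    have h2 : c ^ (orderOf c * orderOf k) = 1 := by rw [pow_mul, pow_orderOf_eq_one, one_pow]
    have h3 : k ^ (orderOf c * orderOf k) = 1 := by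
      rw [mul_comm, pow_mul, pow_orderOf_eq_one, one_pow]
    rw [hk, huk.mul_pow, ← hk, h3, mul_one] at h2
    exact h2
  have h4 : Nat.Coprime (orderOf c * orderOf k) p := by
    rw [Nat.coprime_comm, hp.out.coprime_iff_not_dvd, hp.out.dvd_mul]
    tauto
  have h5 := Nat.dvd_gcd (orderOf_dvd_of_pow_eq_one h1)
    (orderOf_dvd_of_pow_eq_one (h.pow_eq_one P hu))
  rw [h4.gcd_eq_one, Nat.dvd_one, orderOf_eq_one_iff] at h5
  rw [hk, h5, one_mul]
  exact hkQ

/-- By `eq_one_of_commute` such an `S` embeds in the automorphism group of `P`, which is cyclic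
because `P` has prime order. -/
theorem isCyclic_of_le_normalizer (P : Sylow p G) {S : Subgroup G}
    (hS : S ≤ normalizer ((P : Subgroup G) : Set G)) (hSp : ∀ x ∈ S, ¬ p ∣ orderOf x) : IsCyclic S := by
  have : Fact (Nat.card P).Prime := ⟨(h.card_eq P).symm ▸ hp.out⟩
  have : IsCyclic P := isCyclic_of_prime_card rfl
  have : IsCyclic (MulAut P) := isCyclic_of_surjective (IsCyclic.mulAutMulEquiv P).symm
    (IsCyclic.mulAutMulEquiv P).symm.surjective
  refine isCyclic_of_injective (((P : Subgroup G).normalizerMonoidHom).comp (inclusion hS)) ?_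
  rw [injective_iff_map_eq_one]
  rintro ⟨x, hx⟩ hx1
  rw [MonoidHom.comp_apply, ← MonoidHom.mem_ker, normalizerMonoidHom_ker, mem_subgroupOf] at hx1
  refine Subtype.ext (h.eq_one_of_commute P (fun u hu => ?_) (hSp x hx))
  exact (mem_centralizer_iff.1 hx1 u hu).symm

/-- Write `y = u * k`. Since `N(P) ⊓ N(Q)` is cyclic, `x` commutes with `k`, hence with `u`. If `u ≠
1`, it generates `P`, so `x` would centralize `P` and be trivial. -/
theorem mem_normalizer_of_commute (hPQ : P ≠ Q) {x y : G} (hxP : x ∈ normalizer ((P : Subgroup G) : Set G))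
    (hxQ : x ∈ normalizer ((Q : Subgroup G) : Set G)) (hx : x ≠ 1) (hy : y ∈ normalizer ((P : Subgroup G) : Set G))
    (hxy : x * y = y * x) : y ∈ normalizer ((Q : Subgroup G) : Set G) := by
  obtain ⟨u, hu, k, hkP, hkQ, rfl⟩ := h.exists_eq_mul hPQ hy
  have hcyc : IsCyclic (normalizer ((P : Subgroup G) : Set G) ⊓ normalizer ((Q : Subgroup G) : Set G) : Subgroup G) :=
    h.isCyclic_of_le_normalizer P inf_le_left fun z hz => h.not_dvd_orderOf hPQ hz.1 hz.2
  have hxk : Commute x k := by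
    have := hcyc.commGroup.mul_comm ⟨x, mem_inf.2 ⟨hxP, hxQ⟩⟩ ⟨k, mem_inf.2 ⟨hkP, hkQ⟩⟩
    exact congrArg Subtype.val this
  have hxu : Commute x u := by
    have h1 : Commute x (u * k * k⁻¹) := Commute.mul_right hxy hxk.inv_right
    simpa using h1
  by_cases hu1 : u = 1
  · rwa [hu1, one_mul]
  exfalso
  apply hx
  refine h.eq_one_of_commute P (fun v hv => ?_) (h.not_dvd_orderOf hPQ hxP hxQ)
  have : Fact (Nat.card P).Prime := ⟨(h.card_eq P).symm ▸ hp.out⟩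
  have hv' : (⟨v, hv⟩ : P) ∈ zpowers (⟨u, hu⟩ : P) :=
    mem_zpowers_of_prime_card rfl fun h0 => hu1 (congrArg Subtype.val h0)
  obtain ⟨k, hk⟩ := mem_zpowers_iff.1 hv'
  have hk' : u ^ k = v := congrArg Subtype.val hk
  rw [← hk']
  exact (hxu.zpow_right k).eq

end SimpleSylowConfiguration

end Simple

section Simple

open Subgroup

variable {G : Type*} [Group G] [Finite G] {p : ℕ} [hp : Fact p.Prime]

namespace SimpleSylowConfiguration

theorem not_sylow_isPGroup_top (h : SimpleSylowConfiguration G p) {s : ℕ} [hs : Fact s.Prime] :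
    ¬ IsPGroup s (⊤ : Subgroup G) := by
  intro hG
  have P : Sylow p G := default
  obtain ⟨n, hn⟩ := (hG.to_le (le_top : (P : Subgroup G) ≤ ⊤)).exists_card_eq
  have h1 : p ∣ s ^ n := by rw [← hn, h.card_eq P]
  have h2 : p = s := (Nat.prime_dvd_prime_iff_eq hp.out hs.out).1 (hp.out.dvd_of_dvd_pow h1)
  subst h2
  exact h.ne_top P (P.is_maximal' hG le_top).symm

theorem not_isComplement' (h : SimpleSylowConfiguration G p) {s : ℕ} [hs : Fact s.Prime]
    (S : Sylow s G) (hsG : s ∣ Nat.card G) (K : Subgroup G) [hK : K.Normal] :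
    ¬ K.IsComplement' (S : Subgroup G) := by
  intro hc
  rcases h.eq_bot_or_eq_top K hK with rfl | rfl
  · rw [isComplement'_bot_left] at hc
    exact h.not_sylow_isPGroup_top (hc ▸ S.isPGroup')
  · rw [isComplement'_top_left] at hc
    exact S.ne_bot_of_dvd_card hsG hc

/-- For the smallest prime, a cyclic Sylow subgroup would have a normal complement; hence `S` is not
cyclic and normalizes no Sylow `p`-subgroup. Each `S ⊓ N(Q)` is then a proper nontrivial cyclic
normal subgroup of `S`, and two of them meeting trivially make `S` abelian. -/
theorem exists_prime_sylow_commute (h : SimpleSylowConfiguration G p) :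
    ∃ (s : ℕ) (_ : Fact s.Prime) (S : Sylow s G), (Nat.card G).minFac = s ∧ ¬ IsCyclic S ∧
      (∀ x ∈ S, ∀ y ∈ S, x * y = y * x) ∧
      (∀ Q : Sylow p G, ¬ (S : Subgroup G) ≤ normalizer ((Q : Subgroup G) : Set G)) := by
  have P : Sylow p G := default
  have hG1 : Nat.card G ≠ 1 := by
    intro h1
    refine hp.out.one_lt.ne' (Nat.dvd_one.1 ?_)
    rw [← h1, ← h.card_eq P]
    exact card_subgroup_dvd_card _
  obtain ⟨s, hs⟩ : ∃ s, (Nat.card G).minFac = s := ⟨_, rfl⟩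
  have hsG : s ∣ Nat.card G := hs ▸ Nat.minFac_dvd _
  have hsf : Fact s.Prime := ⟨hs ▸ Nat.minFac_prime hG1⟩
  have S : Sylow s G := default
  have hcyc : ¬ IsCyclic S := fun hcyc =>
    h.not_isComplement' S hsG _ (IsCyclic.isComplement' hs hcyc)
  have hsp : s ≠ p := by
    rintro rfl
    exact hcyc (isCyclic_of_prime_card (h.card_eq S))
  have hSp : ∀ x ∈ S, ¬ p ∣ orderOf x := by
    intro x hx hdvd
    obtain ⟨n, hn⟩ := exists_pow_eq_one S hx
    exact hsp ((Nat.prime_dvd_prime_iff_eq hp.out hsf.out).1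
      (hp.out.dvd_of_dvd_pow (hdvd.trans (orderOf_dvd_of_pow_eq_one hn)))).symm
  have hSN : ∀ Q : Sylow p G, ¬ (S : Subgroup G) ≤ normalizer ((Q : Subgroup G) : Set G) :=
    fun Q hle => hcyc (h.isCyclic_of_le_normalizer Q hle hSp)
  refine ⟨s, hsf, S, hs, hcyc, ?_, hSN⟩
  -- the intersections of `S` with the normalizers of the Sylow `p`-subgroups
  set A : Sylow p G → Subgroup G := fun Q => normalizer ((Q : Subgroup G) : Set G) ⊓ S with hA
  have hsup : ∀ Q, ∀ x ∈ S, x ∉ A Q → zpowers x ⊔ A Q = S := by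
    intro Q x hx hxQ
    refine h.sup_inf_normalizer Q (by rwa [zpowers_le]) ?_
    rw [zpowers_le]
    exact fun hxN => hxQ (mem_inf.2 ⟨hxN, hx⟩)
  have hlt : ∀ Q, A Q < S := fun Q =>
    lt_of_le_of_ne inf_le_right fun heq => hSN Q (inf_eq_right.1 heq)
  have hne : ∀ Q, A Q ≠ ⊥ := by
    intro Q hb
    obtain ⟨x, hx, hxA⟩ := SetLike.exists_of_lt (hlt Q)
    have h1 := hsup Q x hx hxA
    rw [hb, sup_bot_eq] at h1
    apply hcyc
    have : IsCyclic (zpowers x) := inferInstance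
    rwa [h1] at this
  have hnorm : ∀ Q, (S : Subgroup G) ≤ normalizer (A Q : Set G) := fun Q =>
    S.isPGroup'.le_normalizer_of_zpowers_sup (hlt Q) (hsup Q)
  have hcomm : ∀ Q, ∀ x ∈ A Q, ∀ y ∈ A Q, x * y = y * x := by
    intro Q x hx y hy
    have hc : IsCyclic (A Q) := h.isCyclic_of_le_normalizer Q inf_le_left fun z hz => hSp z hz.2
    exact congrArg Subtype.val (hc.commGroup.mul_comm ⟨x, hx⟩ ⟨y, hy⟩)
  -- If `A P` met every `A Q` nontrivially, its elements, commuting with those of the intersection,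
  -- would normalize every `Q`, forcing `A P` to be trivial.
  obtain ⟨Q, hQ⟩ : ∃ Q, A P ⊓ A Q = ⊥ := by
    by_contra! hall
    refine hne P (eq_bot_iff.2 fun y hy => mem_bot.2 (h.eq_one_of_forall_mem_normalizer fun Q => ?_))
    by_cases hPQ : P = Q
    · exact hPQ ▸ hy.1
    obtain ⟨x, hx, hx1⟩ := (bot_or_exists_ne_one _).resolve_left (hall Q)
    exact h.mem_normalizer_of_commute hPQ hx.1.1 hx.2.1 hx1 hy.1 (hcomm P x hx.1 y hy)
  obtain ⟨x, hx, hx1⟩ := (bot_or_exists_ne_one _).resolve_left (hne Q)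
  have hxP : x ∉ A P := fun hxP => hx1 (mem_bot.1 (hQ ▸ mem_inf.2 ⟨hxP, hx⟩))
  -- Both `A P` and `A Q` are normal in `S`, so their commutators lie in the trivial intersection.
  have hxA : ∀ a ∈ A P, x * a = a * x := by
    intro a ha
    have h1 : x * a * x⁻¹ ∈ A P := (mem_normalizer_iff.1 (hnorm P hx.2) a).1 ha
    have h2 : a * x⁻¹ * a⁻¹ ∈ A Q := (mem_normalizer_iff.1 (hnorm Q ha.2) x⁻¹).1 (inv_mem hx)
    have h3 : x * a * x⁻¹ * a⁻¹ ∈ A P ⊓ A Q := by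
      refine mem_inf.2 ⟨mul_mem h1 (inv_mem ha), ?_⟩
      have := mul_mem hx h2
      simpa [mul_assoc] using this
    rw [hQ, mem_bot, mul_inv_eq_one, mul_inv_eq_iff_eq_mul] at h3
    exact h3
  have hS := hsup P x hx.2 hxP
  have hcent : (S : Subgroup G) ≤ centralizer ((S : Subgroup G) : Set G) := by
    have hAc : A P ≤ centralizer (A P : Set G) := fun a ha =>
      mem_centralizer_iff.2 fun b hb => hcomm P b hb a ha
    have hxc : zpowers x ≤ centralizer (A P : Set G) := by
      rw [zpowers_le]
      exact mem_centralizer_iff.2 fun b hb => (hxA b hb).symm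
    have hxx : zpowers x ≤ centralizer (zpowers x : Set G) := by
      rw [zpowers_le]
      refine mem_centralizer_iff.2 fun b hb => ?_
      obtain ⟨k, rfl⟩ := mem_zpowers_iff.1 hb
      exact ((Commute.refl x).zpow_left k).eq
    have h1 : (S : Subgroup G) ≤ centralizer (A P : Set G) := hS ▸ sup_le hxc hAc
    have h2 : (S : Subgroup G) ≤ centralizer (zpowers x : Set G) :=
      hS ▸ sup_le hxx (le_centralizer_iff.1 hxc)
    have h3 : zpowers x ⊔ A P ≤ centralizer ((S : Subgroup G) : Set G) :=
      sup_le (le_centralizer_iff.1 h2) (le_centralizer_iff.1 h1)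
    rwa [hS] at h3
  exact fun a ha b hb => (mem_centralizer_iff.1 (hcent hb) a ha)

/-- A proper modular subgroup `M ≥ S` is a maximal subgroup. It turns out to be an `s`-group, so `S
= M` is maximal, self-normalizing and abelian, and Burnside's theorem yields a forbidden normal
complement. -/
theorem elim (h : SimpleSylowConfiguration G p)
    (hIH : ∀ U : Subgroup G, U ≠ ⊤ → ∀ (l : ℕ) [Fact l.Prime],
      (∀ r : ℕ, r.Prime → r ∣ Nat.card U → r ≤ l) → ∀ L : Sylow l U, (L : Subgroup U).Normal) :
    False := by
  obtain ⟨s, hs, S, hmin, hcyc, hcomm, hSN⟩ := h.exists_prime_sylow_commute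
  have hsG : s ∣ Nat.card G := hmin ▸ Nat.minFac_dvd _
  have hStop : (S : Subgroup G) ≠ ⊤ := fun heq =>
    h.not_sylow_isPGroup_top (heq ▸ S.isPGroup')
  obtain ⟨M, hSM, hM, hmod⟩ := h.exists_modularIn S hStop
  have hQM : ∀ Q : Sylow p G, ¬ (Q : Subgroup G) ≤ M := fun Q hle =>
    hSN Q (hSM.trans (h.le_normalizer M hM Q hle))
  have hMQ : ∀ Q : Sylow p G, M ⊔ Q = ⊤ := by
    intro Q
    by_contra hne
    exact hSN Q ((hSM.trans le_sup_left).trans (h.le_normalizer _ hne Q le_sup_right))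
  have hprime : ∀ (Q : Sylow p G) (Z : Subgroup G), ¬ (Q : Subgroup G) ≤ Z →
      (Q : Subgroup G) ⊓ Z = ⊥ := by
    intro Q Z hQZ
    have : Fact (Nat.card Q).Prime := ⟨(h.card_eq Q).symm ▸ hp.out⟩
    rcases ((Z.subgroupOf Q).eq_bot_or_eq_top_of_prime_card) with h1 | h1
    · rw [subgroupOf_eq_bot, disjoint_iff] at h1
      rwa [inf_comm]
    · exact absurd (subgroupOf_eq_top.1 h1) hQZ
  -- Here `Q ⊓ Z` is trivial, since `Q` has prime order and is not contained in `Z`; the second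
  -- modular identity then collapses to `M = Z`.
  have hmax : ∀ Z : Subgroup G, M ≤ Z → Z ≠ ⊤ → Z = M := by
    intro Z hMZ hZ
    have Q : Sylow p G := default
    have h1 := hmod.sup_inf' Q Z le_top hMZ le_top
    have hQZ : ¬ (Q : Subgroup G) ≤ Z := fun hQZ =>
      hZ (top_le_iff.1 (hMQ Q ▸ sup_le hMZ hQZ))
    rw [hprime Q Z hQZ, hMQ Q, sup_bot_eq, top_inf_eq] at h1
    exact h1.symm
  have hMp : ∀ x ∈ M, ¬ p ∣ orderOf x := by
    intro x hx hdvd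
    set y := x ^ (orderOf x / p)
    have hy : orderOf y = p := orderOf_pow_orderOf_div (orderOf_pos x).ne' hdvd
    have hcard : Nat.card (zpowers y) = p := (Nat.card_zpowers y).trans hy
    have hyP : IsPGroup p (zpowers y) := IsPGroup.of_card (n := 1) (by rw [hcard, pow_one])
    obtain ⟨Q, hQ⟩ := hyP.exists_le_sylow
    have : zpowers y = Q := eq_of_le_of_card_ge hQ (by rw [hcard, h.card_eq Q])
    refine hQM Q ?_
    rw [← this, zpowers_le]
    exact pow_mem hx _
  have hMs : IsPGroup s M := by
    by_contra hMs
    -- the largest prime divisor of `|M|`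
    have hMcard : Nat.card M ≠ 0 := Nat.card_pos.ne'
    have hsM : s ∈ (Nat.card M).primeFactors := Nat.mem_primeFactors.2
      ⟨hs.out, (S.dvd_card_of_dvd_card hsG).trans (card_dvd_of_le hSM), hMcard⟩
    obtain ⟨l, hlM, hlmax⟩ := (Nat.card M).primeFactors.exists_max_image id ⟨s, hsM⟩
    have hl : Fact l.Prime := ⟨Nat.prime_of_mem_primeFactors hlM⟩
    have hlmax' : ∀ r : ℕ, r.Prime → r ∣ Nat.card M → r ≤ l := fun r hr hrM =>
      hlmax r (Nat.mem_primeFactors.2 ⟨hr, hrM, hMcard⟩)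
    -- The prime `s` is the smallest divisor of the order of `G`; were it also the largest divisor
    -- of the order of `M`, then `M` would be an `s`-group.
    have hls : l ≠ s := by
      rintro rfl
      refine hMs (IsPGroup.of_card (Nat.eq_prime_pow_of_unique_prime_dvd hMcard fun {r} hr hrM =>
        (hlmax' r hr hrM).antisymm ?_))
      rw [← hmin]
      exact Nat.minFac_le_of_dvd hr.two_le (hrM.trans (card_subgroup_dvd_card M))
    have L : Sylow l M := default
    have hLn : (L : Subgroup M).Normal := hIH M hM l hlmax' L
    -- Otherwise `M` is generated by `L` and the cyclic group `N(Q) ⊓ M`, so `M / L` is cyclic. As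
    -- `l ≠ s`, the group `S` embeds in it, but `S` is not cyclic.
    have hLQ : ∀ Q : Sylow p G,
        (L : Subgroup M).map M.subtype ≤ normalizer ((Q : Subgroup G) : Set G) := by
      intro Q
      by_contra hle
      set A : Subgroup G := normalizer ((Q : Subgroup G) : Set G) ⊓ M
      have hAc : IsCyclic A := h.isCyclic_of_le_normalizer Q inf_le_left fun z hz => hMp z hz.2
      have h1 : (L : Subgroup M).map M.subtype ⊔ A = M :=
        h.sup_inf_normalizer Q (map_subtype_le _) hle
      have h2 : (L : Subgroup M) ⊔ A.subgroupOf M = ⊤ := by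
        apply map_injective M.subtype_injective
        rw [Subgroup.map_sup, map_subgroupOf_eq_of_le inf_le_right, h1, ← MonoidHom.range_eq_map,
          range_subtype]
      have h3 : IsCyclic (M ⧸ (L : Subgroup M)) := by
        refine isCyclic_of_surjective
          ((QuotientGroup.mk' (L : Subgroup M)).comp (inclusion (inf_le_right : A ≤ M))) ?_
        intro x
        obtain ⟨m, rfl⟩ := QuotientGroup.mk'_surjective _ x
        obtain ⟨y, hy, z, hz, rfl⟩ := mem_sup_of_normal_left.1 (h2 ▸ mem_top m)
        refine ⟨⟨z, hz⟩, ?_⟩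
        have hy1 : QuotientGroup.mk' (L : Subgroup M) y = 1 := (QuotientGroup.eq_one_iff y).2 hy
        exact (by rw [map_mul, hy1, one_mul] : QuotientGroup.mk' (L : Subgroup M) (y * z) =
          QuotientGroup.mk' (L : Subgroup M) z).symm
      refine hcyc (isCyclic_of_injective
        ((QuotientGroup.mk' (L : Subgroup M)).comp (inclusion hSM)) ?_)
      rw [injective_iff_map_eq_one]
      rintro ⟨x, hx⟩ hx1
      have hxL : inclusion hSM ⟨x, hx⟩ ∈ L := (QuotientGroup.eq_one_iff _).1 hx1
      obtain ⟨m, hm⟩ := exists_pow_eq_one S hx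
      obtain ⟨n, hn⟩ := exists_pow_eq_one L hxL
      have hn' : x ^ l ^ n = 1 := congrArg Subtype.val hn
      have h4 := Nat.dvd_gcd (orderOf_dvd_of_pow_eq_one hm) (orderOf_dvd_of_pow_eq_one hn')
      rw [(((Nat.coprime_primes hs.out hl.out).2 hls.symm).pow m n).gcd_eq_one, Nat.dvd_one,
        orderOf_eq_one_iff] at h4
      exact Subtype.ext h4
    refine L.ne_bot_of_dvd_card (Nat.dvd_of_mem_primeFactors hlM) (eq_bot_iff.2 fun x hx => ?_)
    exact mem_bot.2 (Subtype.ext (h.eq_one_of_forall_mem_normalizer fun Q => hLQ Q ⟨x, hx, rfl⟩))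
  have hMS : M = S := S.is_maximal' hMs hSM
  have hSn : normalizer ((S : Subgroup G) : Set G) = S := by
    rw [← hMS]
    refine hmax _ Subgroup.le_normalizer fun htop => ?_
    rcases h.eq_bot_or_eq_top M (normalizer_eq_top_iff.1 htop) with h1 | h1
    · exact S.ne_bot_of_dvd_card hsG (hMS ▸ h1)
    · exact hM h1
  have hN : normalizer ((S : Subgroup G) : Set G) ≤ centralizer ((S : Subgroup G) : Set G) := by
    rw [hSn]
    exact fun x hx => mem_centralizer_iff.2 fun y hy => hcomm y hy x hx
  exact h.not_isComplement' S hsG _ (MonoidHom.ker_transferSylow_isComplement' S hN)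

end SimpleSylowConfiguration

end Simple

/-! ## Sylow towers and solubility -/

section MinimalNormal

variable {G : Type*} [Group G] [Finite G]

theorem Subgroup.exists_minimal_normal_le {N : Subgroup G} (hN : N.Normal) (hne : N ≠ ⊥) :
    ∃ L : Subgroup G, L.Normal ∧ L ≤ N ∧ L ≠ ⊥ ∧
      ∀ K : Subgroup G, K.Normal → K ≤ L → K = ⊥ ∨ K = L := by
  obtain ⟨L, hL⟩ := exists_minimal_of_wellFoundedLT
    (fun L : Subgroup G => L.Normal ∧ L ≤ N ∧ L ≠ ⊥) ⟨N, hN, le_rfl, hne⟩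
  refine ⟨L, hL.prop.1, hL.prop.2.1, hL.prop.2.2, fun K hK hKL => ?_⟩
  by_cases hK1 : K = ⊥
  · exact Or.inl hK1
  · exact Or.inr (hKL.antisymm (hL.le_of_le ⟨hK, hKL.trans hL.prop.2.1, hK1⟩ hKL))

open scoped commutatorElement in
/-- A soluble minimal normal subgroup is elementary abelian. -/
theorem Subgroup.exists_prime_of_minimal_normal {N : Subgroup G} (hN : N.Normal) (hne : N ≠ ⊥)
    (hmin : ∀ K : Subgroup G, K.Normal → K ≤ N → K = ⊥ ∨ K = N) (hsol : Group.IsSolvable N) :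
    ∃ r : ℕ, r.Prime ∧ r ∣ Nat.card N ∧ (∀ a ∈ N, a ^ r = 1) ∧
      ∀ a ∈ N, ∀ b ∈ N, a * b = b * a := by
  have hab : ∀ a ∈ N, ∀ b ∈ N, a * b = b * a := by
    have hle : ⁅N, N⁆ ≤ N := Subgroup.commutator_le_left N N
    rcases hmin ⁅N, N⁆ inferInstance hle with h1 | h1
    · intro a ha b hb
      have h2 : ⁅a, b⁆ ∈ ⁅N, N⁆ := Subgroup.commutator_mem_commutator ha hb
      rw [h1, Subgroup.mem_bot, commutatorElement_eq_one_iff_mul_comm] at h2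
      exact h2
    · exfalso
      have : Nontrivial N := (Subgroup.nontrivial_iff_ne_bot N).2 hne
      have h2 := Group.IsSolvable.commutator_lt_top_of_nontrivial N
      have h3 := Subgroup.map_subtype_commutator N
      rw [h1] at h3
      refine h2.ne (Subgroup.map_injective N.subtype_injective ?_)
      rw [h3, ← MonoidHom.range_eq_map, Subgroup.range_subtype]
  have hcard : Nat.card N ≠ 1 := fun h1 => hne (Subgroup.card_eq_one.1 h1)
  obtain ⟨r, hr, hrN⟩ := Nat.exists_prime_and_dvd hcard
  have hrf : Fact r.Prime := ⟨hr⟩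
  refine ⟨r, hr, hrN, ?_, hab⟩
  let R : Subgroup G :=
    { carrier := {a | a ∈ N ∧ a ^ r = 1}
      one_mem' := ⟨N.one_mem, one_pow r⟩
      mul_mem' := fun {a b} ha hb => ⟨N.mul_mem ha.1 hb.1, by
        rw [(show Commute a b from hab a ha.1 b hb.1).mul_pow, ha.2, hb.2, one_mul]⟩
      inv_mem' := fun {a} ha => ⟨N.inv_mem ha.1, by rw [inv_pow, ha.2, inv_one]⟩ }
  have hR : R.Normal := ⟨fun a ha g => ⟨hN.conj_mem a ha.1 g, by
    rw [conj_pow, ha.2, mul_one, mul_inv_cancel]⟩⟩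
  rcases hmin R hR (fun a ha => ha.1) with h1 | h1
  · exfalso
    obtain ⟨⟨a, ha⟩, hord⟩ := exists_prime_orderOf_dvd_card' r hrN
    rw [Subgroup.orderOf_mk] at hord
    have : a ∈ R := ⟨ha, by rw [← hord, pow_orderOf_eq_one]⟩
    rw [h1, Subgroup.mem_bot] at this
    rw [this, orderOf_one] at hord
    exact hr.one_lt.ne hord
  · intro a ha
    rw [← h1] at ha
    exact ha.2

end MinimalNormal

theorem Commute.of_pow_left_of_coprime {G : Type*} [Group G] {x a : G} {m n : ℕ}
    (h : m.Coprime n) (hm : Commute (x ^ m) a) (hn : Commute (x ^ n) a) : Commute x a := by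
  obtain ⟨u, v, huv⟩ := Nat.isCoprime_iff_coprime.2 h
  have : x = (x ^ m) ^ u * (x ^ n) ^ v := by
    rw [← zpow_natCast, ← zpow_natCast, ← zpow_mul, ← zpow_mul, ← zpow_add, mul_comm (m : ℤ),
      mul_comm (n : ℤ), huv, zpow_one]
  rw [this]
  exact (hm.zpow_left u).mul_left (hn.zpow_left v)

theorem Subgroup.card_lt_of_ne_top {G : Type*} [Group G] [Finite G] {U : Subgroup G}
    (hU : U ≠ ⊤) : Nat.card U < Nat.card G :=
  lt_of_le_of_ne U.card_le_card_group fun h => hU (U.card_eq_iff_eq_top.1 h)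

theorem Subgroup.card_quotient_lt_of_ne_bot {G : Type*} [Group G] [Finite G] {N : Subgroup G}
    (hN : N ≠ ⊥) : Nat.card (G ⧸ N) < Nat.card G := by
  rw [N.card_eq_card_quotient_mul_card_subgroup]
  exact lt_mul_of_one_lt_right Nat.card_pos (N.one_lt_card_iff_ne_bot.2 hN)

theorem Sylow.le_normalizer_of_normal_subtype {G : Type*} [Group G] {p : ℕ} {P : Sylow p G}
    {U : Subgroup G} (hP : (P : Subgroup G) ≤ U) (h : (P.subtype hP : Subgroup U).Normal) :
    U ≤ Subgroup.normalizer ((P : Subgroup G) : Set G) :=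
  (Subgroup.normal_subgroupOf_iff_le_normalizer hP).1 h

/-- The two claims need each other: solubility of proper subgroups makes a proper minimal normal
subgroup elementary abelian, and normality gives a soluble quotient. The prime `p` need not divide
the order, so its bound passes to subgroups and quotients. -/
theorem SylowSubmodular.normal_and_isSolvable_of_card (n : ℕ) :
    ∀ (G : Type u) [Group G] [Finite G], Nat.card G = n → SylowSubmodular G →
      (∀ (p : ℕ) [Fact p.Prime], (∀ r : ℕ, r.Prime → r ∣ Nat.card G → r ≤ p) →
        ∀ P : Sylow p G, (P : Subgroup G).Normal) ∧ Group.IsSolvable G := by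
  induction n using Nat.strong_induction_on with
  | h n ih =>
  intro G _ _ hn hG
  have ihU := fun (U : Subgroup G) (hU : U ≠ ⊤) =>
    ih _ (hn ▸ Subgroup.card_lt_of_ne_top hU) U rfl (hG.subgroup U)
  have ihQ := fun (N : Subgroup G) (hN : N.Normal) (hne : N ≠ ⊥) =>
    ih _ (hn ▸ Subgroup.card_quotient_lt_of_ne_bot hne) (G ⧸ N) rfl
      (hG.of_surjective (QuotientGroup.mk'_surjective N))
  have hnormal : ∀ (p : ℕ) [Fact p.Prime], (∀ r : ℕ, r.Prime → r ∣ Nat.card G → r ≤ p) →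
        ∀ P : Sylow p G, (P : Subgroup G).Normal := by
    intro p hp hmax P
    have hle : ∀ U : Subgroup G, U ≠ ⊤ → ∀ P : Sylow p G, (P : Subgroup G) ≤ U →
        U ≤ Subgroup.normalizer ((P : Subgroup G) : Set G) := by
      intro U hU P hP
      exact Sylow.le_normalizer_of_normal_subtype hP ((ihU U hU).1 p
        (fun r hr hrU => hmax r hr (hrU.trans (Subgroup.card_subgroup_dvd_card U))) _)
    by_contra hP
    by_cases hS : ∀ N : Subgroup G, N.Normal → N = ⊥ ∨ N = ⊤
    · refine SimpleSylowConfiguration.elim (p := p) ⟨hS, fun Q hQ => hP ?_, hle, hG⟩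
        fun U hU => (ihU U hU).1
      have : Subsingleton (Sylow p G) := by
        have := Sylow.unique_of_normal Q hQ
        infer_instance
      exact Sylow.normal_of_subsingleton P
    · push Not at hS
      obtain ⟨N, hN, hNb, hNt⟩ := hS
      obtain ⟨L, hL, hLN, hLb, hLmin⟩ := Subgroup.exists_minimal_normal_le hN hNb
      have hLt : L ≠ ⊤ := fun h => hNt (top_le_iff.1 (h ▸ hLN))
      obtain ⟨r, hr, hrL, hexp, hab⟩ :=
        Subgroup.exists_prime_of_minimal_normal hL hLb hLmin (ihU L hLt).2
      -- If `PL` is proper, it is normal because its image in `G / L` is a normal Sylow subgroup,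
      -- and `P` is characteristic in `PL`.
      have hsup : (P : Subgroup G) ⊔ L = ⊤ := by
        by_contra hne
        have h1 : ((P : Subgroup G).map (QuotientGroup.mk' L)).Normal :=
          (ihQ L hL hLb).1 p (fun r hr hrL => hmax r hr
            (hrL.trans (Subgroup.card_quotient_dvd_card L)))
            (P.mapSurjective (QuotientGroup.mk'_surjective L))
        have h2 : ((P : Subgroup G) ⊔ L).Normal := by
          have := h1.comap (QuotientGroup.mk' L)
          rwa [QuotientGroup.comap_map_mk', sup_comm] at this
        let R : Sylow p ((P : Subgroup G) ⊔ L : Subgroup G) := P.subtype le_sup_left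
        have h3 := (ihU _ hne).1 p (fun r hr hrU => hmax r hr
            (hrU.trans (Subgroup.card_subgroup_dvd_card _))) R
        have h4 := Sylow.characteristic_of_normal _ h3
        have h5 := ConjAct.normal_of_characteristic_of_normal
          (H := (P : Subgroup G) ⊔ L) (K := R.toSubgroup)
        rw [Sylow.coe_subtype, Subgroup.map_subgroupOf_eq_of_le le_sup_left] at h5
        exact hP h5
      have hrp : r ≠ p := by
        rintro rfl
        have hLp : IsPGroup r L := fun a => ⟨1, Subtype.ext (by simpa using hexp a a.2)⟩
        have h1 := P.is_maximal' (P.isPGroup'.to_sup_of_normal_right hLp) le_sup_left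
        rw [hsup] at h1
        exact hP (h1 ▸ Subgroup.normal_top)
      have hrlt : r < p := lt_of_le_of_ne (hmax r hr
        (hrL.trans (Subgroup.card_subgroup_dvd_card L))) hrp
      -- For `x` in `P` both `x ^ p` and `x ^ (r - 1)` centralize `L`; since `r < p`, the exponents
      -- are coprime, so `x` does.
      have hcop : Nat.Coprime p (r - 1) := by
        rw [hp.out.coprime_iff_not_dvd]
        intro hdvd
        have h1 := Nat.le_of_dvd (Nat.sub_pos_of_lt hr.one_lt) hdvd
        omega
      have hcent : L ≤ Subgroup.normalizer ((P : Subgroup G) : Set G) := by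
        refine le_trans ?_ (Subgroup.centralizer_le_normalizer _)
        intro a ha
        refine Subgroup.mem_centralizer_iff.2 fun x hx => ?_
        exact Commute.of_pow_left_of_coprime hcop
          ((hG p P).commute_pow hr hrp le_top P.isPGroup' hab hexp hx a ha)
          ((hG p P).commute_pow_sub_one hr hrp le_top P.isPGroup' hab hexp hx a ha)
      apply hP
      rw [← Subgroup.normalizer_eq_top_iff, eq_top_iff, ← hsup]
      exact sup_le Subgroup.le_normalizer hcent
  refine ⟨hnormal, ?_⟩
  by_cases h1 : Nat.card G = 1
  · have : Subsingleton G := (Nat.card_eq_one_iff_unique.1 h1).1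
    infer_instance
  have hcard : Nat.card G ≠ 0 := Nat.card_pos.ne'
  obtain ⟨p, hpG, hpmax⟩ := (Nat.card G).primeFactors.exists_max_image id
    ⟨_, Nat.mem_primeFactors.2 ⟨Nat.minFac_prime h1, Nat.minFac_dvd _, hcard⟩⟩
  have hp : Fact p.Prime := ⟨Nat.prime_of_mem_primeFactors hpG⟩
  have P : Sylow p G := default
  have hP := hnormal p (fun r hr hrG => hpmax r (Nat.mem_primeFactors.2 ⟨hr, hrG, hcard⟩)) P
  have hPb := P.ne_bot_of_dvd_card (Nat.dvd_of_mem_primeFactors hpG)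
  have hPn : Group.IsNilpotent P := P.isPGroup'.isNilpotent
  exact (Group.isSolvable_iff_subgroup_quotient (P : Subgroup G)).2
    ⟨inferInstance, (ihQ _ hP hPb).2⟩

section

variable {G : Type u} [Group G] [Finite G]

theorem SylowSubmodular.normal_of_forall_le (hG : SylowSubmodular G) {p : ℕ} [Fact p.Prime]
    (h : ∀ r : ℕ, r.Prime → r ∣ Nat.card G → r ≤ p) (P : Sylow p G) : (P : Subgroup G).Normal :=
  (SylowSubmodular.normal_and_isSolvable_of_card _ G rfl hG).1 p h P

theorem SylowSubmodular.isSolvable (hG : SylowSubmodular G) : Group.IsSolvable G :=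
  (SylowSubmodular.normal_and_isSolvable_of_card _ G rfl hG).2

end

/-! ## The local screen -/

namespace GroupClass

/-- The soluble groups whose Sylow subgroups are abelian of exponent dividing `p - 1` and of
squarefree exponent. -/
def sylowScreen (p : Nat.Primes) : GroupClass.{u} :=
  solubleWithSylowIn ((abelianOfExponentDvd ((p : ℕ) - 1)).inter abelianOfSquarefreeExponent)

/-- In a `q`-group a squarefree exponent is one that divides `q`. -/
theorem mem_sylowScreen_iff {p : Nat.Primes} {G : Type u} [Group G] :
    (sylowScreen p).Mem G ↔ Finite G ∧ Group.IsSolvable G ∧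
      ∀ (q : ℕ) [Fact q.Prime] (P : Sylow q G), ∀ x ∈ P,
        (∀ y ∈ P, x * y = y * x) ∧ x ^ ((p : ℕ) - 1) = 1 ∧ x ^ q = 1 := by
  constructor
  · rintro ⟨⟨hfin, hsol⟩, h⟩
    refine ⟨hfin, hsol, fun q hq P x hx => ?_⟩
    obtain ⟨⟨-, hab, hexp⟩, -, -, hsq⟩ := h q P
    refine ⟨fun y hy => congrArg Subtype.val (hab ⟨x, hx⟩ ⟨y, hy⟩), ?_, ?_⟩
    · have h1 := Monoid.pow_exponent_eq_one (⟨x, hx⟩ : (P : Subgroup G))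
      obtain ⟨m, hm⟩ := hexp
      have h2 : (⟨x, hx⟩ : (P : Subgroup G)) ^ ((p : ℕ) - 1) = 1 := by rw [hm, pow_mul, h1, one_pow]
      exact congrArg Subtype.val h2
    · obtain ⟨n, hn⟩ := P.isPGroup' ⟨x, hx⟩
      have h1 : Squarefree (orderOf (⟨x, hx⟩ : (P : Subgroup G))) :=
        hsq.squarefree_of_dvd (Monoid.order_dvd_exponent _)
      have h2 : orderOf (⟨x, hx⟩ : (P : Subgroup G)) ∣ q ^ (n + 1) :=
        orderOf_dvd_of_pow_eq_one (by rw [pow_succ, pow_mul, hn, one_pow])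
      have h3 := (h1.dvd_pow_iff_dvd n.succ_ne_zero).1 h2
      exact congrArg Subtype.val (orderOf_dvd_iff_pow_eq_one.1 h3)
  · rintro ⟨hfin, hsol, h⟩
    refine ⟨⟨hfin, hsol⟩, fun q hq P => ?_⟩
    have hab : ∀ a b : P, a * b = b * a := fun a b => Subtype.ext ((h q P a a.2).1 b b.2)
    refine ⟨⟨inferInstance, hab, Monoid.exponent_dvd_of_forall_pow_eq_one fun a =>
      Subtype.ext (h q P a a.2).2.1⟩, inferInstance, hab, ?_⟩
    exact (Nat.Prime.prime hq.out).squarefree.squarefree_of_dvd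
      (Monoid.exponent_dvd_of_forall_pow_eq_one fun a => Subtype.ext (h q P a a.2).2.2)

/-- The Sylow conditions become membership in `N` of elements built from Sylow subgroups of `G`, so
they pass from `A` and `B` to `A ⊓ B` at once. -/
theorem mem_sylowScreen_quotient_iff {p : Nat.Primes} {G : Type u} [Group G] [Finite G]
    (N : Subgroup G) [N.Normal] :
    (sylowScreen p).Mem (G ⧸ N) ↔ Group.IsSolvable (G ⧸ N) ∧
      ∀ (q : ℕ) [Fact q.Prime] (P : Sylow q G), ∀ x ∈ P,
        (∀ y ∈ P, (x * y)⁻¹ * (y * x) ∈ N) ∧ x ^ ((p : ℕ) - 1) ∈ N ∧ x ^ q ∈ N := by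
  rw [mem_sylowScreen_iff]
  constructor
  · rintro ⟨-, hsol, h⟩
    refine ⟨hsol, fun q hq P x hx => ?_⟩
    have hP := h q (P.mapSurjective (QuotientGroup.mk'_surjective N))
    have hmem : ∀ y ∈ P, (y : G ⧸ N) ∈ P.mapSurjective (QuotientGroup.mk'_surjective N) :=
      fun y hy => ⟨y, hy, rfl⟩
    obtain ⟨h1, h2, h3⟩ := hP x (hmem x hx)
    exact ⟨fun y hy => QuotientGroup.eq.1 (h1 y (hmem y hy)),
      (QuotientGroup.eq_one_iff _).1 h2, (QuotientGroup.eq_one_iff _).1 h3⟩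
  · rintro ⟨hsol, h⟩
    refine ⟨inferInstance, hsol, fun q hq Q => ?_⟩
    obtain ⟨P, rfl⟩ := Sylow.mapSurjective_surjective (QuotientGroup.mk'_surjective N) q Q
    rintro _ ⟨x, hx, rfl⟩
    obtain ⟨h1, h2, h3⟩ := h q P x hx
    refine ⟨?_, (QuotientGroup.eq_one_iff _).2 h2, (QuotientGroup.eq_one_iff _).2 h3⟩
    rintro _ ⟨y, hy, rfl⟩
    exact QuotientGroup.eq.2 (h1 y hy)

theorem sylowScreen_isFormation (p : Nat.Primes) : (sylowScreen.{u} p).IsFormation := by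
  constructor
  · intro G _ N _ hG
    have := (sylowScreen p).finite hG
    obtain ⟨-, hsol, h⟩ := mem_sylowScreen_iff.1 hG
    refine (mem_sylowScreen_quotient_iff N).2 ⟨inferInstance, fun q hq P x hx => ?_⟩
    obtain ⟨h1, h2, h3⟩ := h q P x hx
    refine ⟨fun y hy => ?_, ?_, ?_⟩
    · rw [h1 y hy, inv_mul_cancel]; exact one_mem N
    · rw [h2]; exact one_mem N
    · rw [h3]; exact one_mem N
  · intro G _ _ A B _ _ hA hB
    obtain ⟨hAs, hA⟩ := (mem_sylowScreen_quotient_iff A).1 hA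
    obtain ⟨hBs, hB⟩ := (mem_sylowScreen_quotient_iff B).1 hB
    refine (mem_sylowScreen_quotient_iff (A ⊓ B)).2 ⟨?_, fun q hq P x hx => ?_⟩
    · refine Group.isSolvable_of_isSolvable_injective
        (f := QuotientGroup.lift (A ⊓ B) ((QuotientGroup.mk' A).prod (QuotientGroup.mk' B)) ?_) ?_
      · intro x hx
        exact Prod.ext ((QuotientGroup.eq_one_iff x).2 hx.1) ((QuotientGroup.eq_one_iff x).2 hx.2)
      · rw [injective_iff_map_eq_one]
        intro x hx
        obtain ⟨x, rfl⟩ := QuotientGroup.mk'_surjective _ x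
        exact (QuotientGroup.eq_one_iff x).2 (Subgroup.mem_inf.2
          ⟨(QuotientGroup.eq_one_iff x).1 (congrArg Prod.fst hx),
            (QuotientGroup.eq_one_iff x).1 (congrArg Prod.snd hx)⟩)
    · obtain ⟨a1, a2, a3⟩ := hA q P x hx
      obtain ⟨b1, b2, b3⟩ := hB q P x hx
      exact ⟨fun y hy => Subgroup.mem_inf.2 ⟨a1 y hy, b1 y hy⟩, Subgroup.mem_inf.2 ⟨a2, b2⟩,
        Subgroup.mem_inf.2 ⟨a3, b3⟩⟩

theorem mem_submodularSylow_iff {G : Type u} [Group G] :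
    submodularSylow.Mem G ↔ Finite G ∧ SylowSubmodular G :=
  and_congr_right fun _ => forall_congr' fun _ => forall_congr' fun _ => forall_congr' fun _ =>
    isSubmodularSubgroup_iff

theorem submodularSylow_isFormation : submodularSylow.{u}.IsFormation := by
  constructor
  · intro G _ N _ hG
    obtain ⟨hfin, hG⟩ := mem_submodularSylow_iff.1 hG
    exact mem_submodularSylow_iff.2
      ⟨inferInstance, hG.of_surjective (QuotientGroup.mk'_surjective N)⟩
  · intro G _ _ A B _ _ hA hB
    refine mem_submodularSylow_iff.2 ⟨inferInstance, SylowSubmodular.of_ker_inf_ker_le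
      (QuotientGroup.mk'_surjective A) (QuotientGroup.mk'_surjective B)
      (QuotientGroup.mk'_surjective (A ⊓ B)) ?_ (mem_submodularSylow_iff.1 hA).2
      (mem_submodularSylow_iff.1 hB).2⟩
    simp only [QuotientGroup.ker_mk', le_refl]

end GroupClass

/-! ## Chief factors as minimal normal subgroups -/

section ChiefFactor

variable {G : Type*} [Group G] {H K : Subgroup G} [K.Normal]

theorem mem_factorCentralizer_iff_commute {g : G} :
    g ∈ factorCentralizer H K ↔
      ∀ n ∈ H.map (QuotientGroup.mk' K), (g : G ⧸ K) * n = n * g := by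
  rw [factorCentralizer, Subgroup.mem_comap, Subgroup.mem_centralizer_iff]
  exact forall_congr' fun n => forall_congr' fun _ => eq_comm

theorem card_map_mk'_eq_relIndex :
    Nat.card (H.map (QuotientGroup.mk' K)) = K.relIndex H := by
  rw [← Subgroup.relIndex_ker, QuotientGroup.ker_mk']

theorem IsChiefFactor.map_normal (h : IsChiefFactor H K) :
    (H.map (QuotientGroup.mk' K)).Normal :=
  h.normal_top.map _ (QuotientGroup.mk'_surjective K)

theorem IsChiefFactor.map_ne_bot (h : IsChiefFactor H K) : H.map (QuotientGroup.mk' K) ≠ ⊥ := by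
  rw [Ne, Subgroup.map_eq_bot_iff, QuotientGroup.ker_mk']
  exact not_le_of_gt h.lt

theorem IsChiefFactor.eq_bot_or_eq_map (h : IsChiefFactor H K) (L : Subgroup (G ⧸ K))
    (hL : L.Normal) (hLH : L ≤ H.map (QuotientGroup.mk' K)) :
    L = ⊥ ∨ L = H.map (QuotientGroup.mk' K) := by
  have hmc := Subgroup.map_comap_eq_self_of_surjective (QuotientGroup.mk'_surjective K)
  have hKL : K ≤ L.comap (QuotientGroup.mk' K) := by
    have := Subgroup.ker_le_comap (QuotientGroup.mk' K) L
    rwa [QuotientGroup.ker_mk'] at this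
  have hLH' : L.comap (QuotientGroup.mk' K) ≤ H := by
    have := Subgroup.comap_mono (f := QuotientGroup.mk' K) hLH
    rwa [QuotientGroup.comap_map_mk', sup_eq_right.2 h.lt.le] at this
  rcases h.eq_or_eq _ (hL.comap _) hKL hLH' with h1 | h1
  · left
    rw [← hmc L, h1, Subgroup.map_eq_bot_iff, QuotientGroup.ker_mk']
  · right
    rw [← h1, hmc]

theorem IsChiefFactor.elementaryAbelian [Finite G] (h : IsChiefFactor H K)
    (hsol : Group.IsSolvable (H.map (QuotientGroup.mk' K))) {p : ℕ} (hp : p.Prime)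
    (hpH : p ∣ K.relIndex H) :
    (∀ a ∈ H.map (QuotientGroup.mk' K), a ^ p = 1) ∧
      ∀ a ∈ H.map (QuotientGroup.mk' K), ∀ b ∈ H.map (QuotientGroup.mk' K), a * b = b * a := by
  obtain ⟨r, hr, -, hexp, hab⟩ := Subgroup.exists_prime_of_minimal_normal h.map_normal h.map_ne_bot
    h.eq_bot_or_eq_map hsol
  have hpf : Fact p.Prime := ⟨hp⟩
  rw [← card_map_mk'_eq_relIndex] at hpH
  obtain ⟨a, ha⟩ := exists_prime_orderOf_dvd_card' p hpH
  have hpr : p = r := (Nat.prime_dvd_prime_iff_eq hp hr).1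
    (ha ▸ orderOf_dvd_of_pow_eq_one (Subtype.ext (hexp a a.2)))
  exact ⟨hpr ▸ hexp, hab⟩

end ChiefFactor

/-! ### Submodular Sylow subgroups imply the conditions of the screen -/

/-- A nontrivial normal `p`-subgroup contains a nontrivial fixed point of every `p`-subgroup. -/
theorem IsPGroup.exists_commute_of_normal {G : Type*} [Group G] [Finite G] {p : ℕ}
    [hp : Fact p.Prime] {P N : Subgroup G} [N.Normal] (hP : IsPGroup p P) (hN : IsPGroup p N)
    (hne : N ≠ ⊥) : ∃ a ∈ N, a ≠ 1 ∧ ∀ x ∈ P, x * a = a * x := by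
  let _ : MulAction P N := MulAction.compHom N ((MulAut.conjNormal (H := N)).comp P.subtype)
  have hsmul : ∀ (x : P) (a : N), ((x • a : N) : G) = x * a * (x : G)⁻¹ := fun x a => rfl
  have hdvd : p ∣ Nat.card N := by
    rcases hN.card_eq_or_dvd with h1 | h1
    · exact absurd (Subgroup.card_eq_one.1 h1) hne
    · exact h1
  obtain ⟨b, hb, hb1⟩ := hP.exists_fixed_point_of_prime_dvd_card_of_fixed_point N hdvd
    (a := 1) (fun x => Subtype.ext (by rw [hsmul]; simp))
  refine ⟨b, b.2, fun h => hb1 (Subtype.ext h.symm), fun x hx => ?_⟩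
  have := congrArg Subtype.val (hb ⟨x, hx⟩)
  rw [hsmul, mul_inv_eq_iff_eq_mul] at this
  exact this

section Local

variable {G : Type u} [Group G] [Finite G]

/-- A chief factor which is a `p`-group is centralized by the Sylow `p`-subgroups of `G`, if the
image of some Sylow `p`-subgroup in the group of induced automorphisms is normal. -/
theorem IsChiefFactor.sylow_le_factorCentralizer {H K : Subgroup G} [H.Normal] [K.Normal]
    (h : IsChiefFactor H K) {p : ℕ} [Fact p.Prime]
    (hexp : ∀ a ∈ H.map (QuotientGroup.mk' K), a ^ p = 1) (P : Sylow p G)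
    (hP : ((P : Subgroup G).map (QuotientGroup.mk' (factorCentralizer H K))).Normal) :
    (P : Subgroup G) ≤ factorCentralizer H K := by
  set C := factorCentralizer H K with hC
  set N := H.map (QuotientGroup.mk' K) with hN
  have hNn : N.Normal := h.map_normal
  have hNp : IsPGroup p N := fun a => ⟨1, Subtype.ext (by simpa using hexp a a.2)⟩
  have hR : (C ⊔ (P : Subgroup G)).Normal := by
    have := hP.comap (QuotientGroup.mk' C)
    rwa [QuotientGroup.comap_map_mk'] at this
  set R := (C ⊔ (P : Subgroup G)).map (QuotientGroup.mk' K) with hRdef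
  have hRn : R.Normal := hR.map _ (QuotientGroup.mk'_surjective K)
  -- A fixed point of `P` in `N` is also centralized by `C`, hence by `R`. As `R` is normal, its
  -- centralizer in `N` is a nontrivial normal subgroup, so it is `N` by minimality.
  obtain ⟨a, haN, ha1, ha⟩ := IsPGroup.exists_commute_of_normal
    (P.isPGroup'.map (QuotientGroup.mk' K)) hNp h.map_ne_bot
  have haR : a ∈ Subgroup.centralizer (R : Set (G ⧸ K)) := by
    rw [Subgroup.mem_centralizer_iff]
    suffices hle : R ≤ Subgroup.centralizer {a} from fun x hx =>
      (Subgroup.mem_centralizer_iff.1 (hle hx) a rfl).symm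
    rw [hRdef, Subgroup.map_sup]
    refine sup_le ?_ fun x hx => ?_
    · rintro _ ⟨c, hc, rfl⟩
      rw [Subgroup.mem_centralizer_singleton_iff]
      exact mem_factorCentralizer_iff_commute.1 hc a haN
    · rw [Subgroup.mem_centralizer_singleton_iff]
      exact ha x hx
  rcases h.eq_bot_or_eq_map (N ⊓ Subgroup.centralizer (R : Set (G ⧸ K))) inferInstance
    inf_le_left with h1 | h1
  · exact absurd (Subgroup.mem_bot.1 (h1 ▸ Subgroup.mem_inf.2 ⟨haN, haR⟩)) ha1
  · intro x hx
    refine mem_factorCentralizer_iff_commute.2 fun n hn => ?_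
    have hn' : n ∈ N ⊓ Subgroup.centralizer (R : Set (G ⧸ K)) := by rw [h1]; exact hn
    exact Subgroup.mem_centralizer_iff.1 (Subgroup.mem_inf.1 hn').2 _
      ⟨x, (le_sup_right : (P : Subgroup G) ≤ C ⊔ P) hx, rfl⟩

/-- For `q ≠ p` the conditions are the three action lemmas in `G / K`. They also force every other
prime divisor of the order of `G / C` to divide `p - 1`. So `p` bounds these primes, the image of a
Sylow `p`-subgroup in `G / C` is normal, and it acts trivially on the factor. -/
theorem SylowSubmodular.mem_localClass (hG : SylowSubmodular G) :
    (GroupClass.localClass GroupClass.sylowScreen.{u}).Mem G := by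
  refine ⟨inferInstance, fun H K _ _ h p hpH => ?_⟩
  have hp : Fact (p : ℕ).Prime := ⟨p.2⟩
  have hsol : Group.IsSolvable G := hG.isSolvable
  have hNn := h.map_normal
  obtain ⟨hexp, hab⟩ := h.elementaryAbelian inferInstance p.2 hpH
  have hGK := hG.of_surjective (QuotientGroup.mk'_surjective K)
  have hne : ∀ (q : ℕ) [Fact q.Prime], (p : ℕ) ≠ q → ∀ (P : Sylow q G), ∀ x ∈ P,
      (∀ y ∈ P, (x * y)⁻¹ * (y * x) ∈ factorCentralizer H K) ∧
        x ^ ((p : ℕ) - 1) ∈ factorCentralizer H K ∧ x ^ q ∈ factorCentralizer H K := by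
    intro q hq hpq P x hx
    have hsub := hGK q (P.mapSurjective (QuotientGroup.mk'_surjective K))
    have hmem : ∀ y ∈ P, (y : G ⧸ K) ∈
        (P.mapSurjective (QuotientGroup.mk'_surjective K) : Subgroup (G ⧸ K)) :=
      fun y hy => ⟨y, hy, rfl⟩
    have hPq := (P.mapSurjective (QuotientGroup.mk'_surjective K)).isPGroup'
    refine ⟨fun y hy => ?_, ?_, ?_⟩ <;> rw [mem_factorCentralizer_iff_commute]
    · have h1 := hsub.commute_commutator p.2 hpq le_top hPq hab hexp
        (inv_mem (hmem y hy)) (inv_mem (hmem x hx))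
      rw [inv_inv, inv_inv] at h1
      intro n hn
      have h2 := h1 n hn
      have h3 : (((x * y)⁻¹ * (y * x) : G) : G ⧸ K) = (y : G ⧸ K)⁻¹ * (x : G ⧸ K)⁻¹ * y * x := by
        rw [show (x * y)⁻¹ * (y * x) = y⁻¹ * x⁻¹ * y * x by group]
        rfl
      rw [h3]
      exact h2
    · exact hsub.commute_pow_sub_one p.2 hpq le_top hPq hab hexp (hmem x hx)
    · exact hsub.commute_pow p.2 hpq le_top hPq hab hexp (hmem x hx)
  refine (GroupClass.mem_sylowScreen_quotient_iff _).2 ⟨inferInstance, fun q hq P x hx => ?_⟩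
  by_cases hpq : (p : ℕ) = q
  · subst hpq
    have hGC := hG.of_surjective (QuotientGroup.mk'_surjective (factorCentralizer H K))
    have hle : (P : Subgroup G) ≤ factorCentralizer H K := by
      refine h.sylow_le_factorCentralizer hexp P ?_
      refine hGC.normal_of_forall_le ?_
        (P.mapSurjective (QuotientGroup.mk'_surjective (factorCentralizer H K)))
      intro r hr hrC
      by_cases hpr : (p : ℕ) = r
      · exact hpr.ge
      have hrf : Fact r.Prime := ⟨hr⟩
      have T : Sylow r G := default
      refine (Nat.le_of_dvd (Nat.sub_pos_of_lt p.2.one_lt) ?_).trans (Nat.sub_le _ 1)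
      -- If `r` does not divide `p - 1`, then `t ^ r` and `t ^ (p - 1)` have coprime exponents and
      -- centralize the factor, so `T ≤ C`, although `r` divides the order of `G / C`.
      by_contra hdvd
      refine (T.mapSurjective (QuotientGroup.mk'_surjective
        (factorCentralizer H K))).ne_bot_of_dvd_card hrC ?_
      rw [Sylow.coe_mapSurjective, Subgroup.map_eq_bot_iff, QuotientGroup.ker_mk']
      intro t ht
      obtain ⟨-, h1, h2⟩ := hne r hpr T t ht
      rw [mem_factorCentralizer_iff_commute] at h1 h2 ⊢
      exact fun n hn => Commute.of_pow_left_of_coprime ((hr.coprime_iff_not_dvd).2 hdvd)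
        (h2 n hn) (h1 n hn)
    exact ⟨fun y hy => mul_mem (inv_mem (mul_mem (hle hx) (hle hy))) (mul_mem (hle hy) (hle hx)),
      pow_mem (hle hx) _, pow_mem (hle hx) _⟩
  · exact hne q hpq P x hx

end Local

/-! ## Actions by power automorphisms -/

/-- An endomorphism `φ` with `φ ^ p = φ` of a nontrivial elementary abelian `p`-group has an
eigenvector. -/
theorem MonoidHom.exists_apply_eq_pow {A : Type*} [CommGroup A] [Finite A] [Nontrivial A] {p : ℕ}
    [hp : Fact p.Prime] (hexp : ∀ a : A, a ^ p = 1) (φ : A →* A) (hφ : ∀ a, φ^[p] a = φ a) :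
    ∃ k : ℕ, ∃ a : A, a ≠ 1 ∧ φ a = a ^ k := by
  let _ : Module (ZMod p) (Additive A) :=
    AddCommGroup.zmodModule (n := p) (G := Additive A) fun a => congrArg Additive.ofMul (hexp a.toMul)
  let f : Module.End (ZMod p) (Additive A) := φ.toAdditive.toZModLinearMap p
  -- The hypothesis on `φ` makes `f` a root of `X ^ p - X`, which splits over the prime field; hence
  -- the minimal polynomial has a root there, an eigenvalue.
  have hf : Polynomial.aeval f (Polynomial.X ^ p - Polynomial.X : Polynomial (ZMod p)) = 0 := by
    rw [map_sub, map_pow, Polynomial.aeval_X, sub_eq_zero]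
    refine LinearMap.ext fun v => ?_
    rw [Module.End.pow_apply]
    have hiter : ∀ n : ℕ, f^[n] v = Additive.ofMul (φ^[n] v.toMul) := by
      intro n
      induction n with
      | zero => rfl
      | succ n ih => rw [Function.iterate_succ_apply', ih, Function.iterate_succ_apply']; rfl
    rw [hiter, hφ]
    rfl
  have hdvd := minpoly.dvd (ZMod p) f hf
  have hne : (Polynomial.X ^ p - Polynomial.X : Polynomial (ZMod p)) ≠ 0 :=
    FiniteField.X_pow_card_sub_X_ne_zero (ZMod p) hp.out.one_lt
  have hfin : Module.Finite (ZMod p) (Additive A) := Module.Finite.of_finite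
  have hint : IsIntegral (ZMod p) f := Algebra.IsIntegral.isIntegral f
  obtain ⟨μ, hμ⟩ := ((GaloisField.splits_zmod_X_pow_sub_X p).of_dvd hne hdvd).exists_eval_eq_zero
    (minpoly.degree_pos hint).ne'
  obtain ⟨v, hv⟩ := (Module.End.hasEigenvalue_of_isRoot hμ).exists_hasEigenvector
  refine ⟨μ.val, v.toMul, fun h => hv.2 (congrArg Additive.ofMul h), ?_⟩
  have h1 : f v = μ • v := hv.apply_eq_smul
  rw [← ZMod.natCast_zmod_val μ, Nat.cast_smul_eq_nsmul] at h1
  exact congrArg Additive.toMul h1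

/-- Count prime factors with multiplicity: a divisor of `p * q` has at most two. -/
theorem Nat.eq_one_of_mul_mul_dvd_prime_mul {p q a b c : ℕ} (hp : p.Prime) (hq : q.Prime)
    (h : a * b * c ∣ p * q) : a = 1 ∨ b = 1 ∨ c = 1 := by
  obtain ⟨d, hd⟩ := h
  have h0 : a * b * c * d ≠ 0 := hd ▸ mul_ne_zero hp.ne_zero hq.ne_zero
  have hd0 := right_ne_zero_of_mul h0
  have habc := left_ne_zero_of_mul h0
  have hc := right_ne_zero_of_mul habc
  have hab := left_ne_zero_of_mul habc
  have hb := right_ne_zero_of_mul hab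
  have ha := left_ne_zero_of_mul hab
  have h1 := congrArg ArithmeticFunction.cardFactors hd
  rw [ArithmeticFunction.cardFactors_mul hp.ne_zero hq.ne_zero,
    ArithmeticFunction.cardFactors_apply_prime hp, ArithmeticFunction.cardFactors_apply_prime hq,
    ArithmeticFunction.cardFactors_mul habc hd0, ArithmeticFunction.cardFactors_mul hab hc,
    ArithmeticFunction.cardFactors_mul ha hb] at h1
  by_contra! hne
  have ha1 := ArithmeticFunction.cardFactors_pos_iff_one_lt.2 (lt_of_le_of_ne (Nat.pos_of_ne_zero ha) hne.1.symm)
  have hb1 := ArithmeticFunction.cardFactors_pos_iff_one_lt.2 (lt_of_le_of_ne (Nat.pos_of_ne_zero hb) hne.2.1.symm)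
  have hc1 := ArithmeticFunction.cardFactors_pos_iff_one_lt.2 (lt_of_le_of_ne (Nat.pos_of_ne_zero hc) hne.2.2.symm)
  omega

/-- All subgroups of a group whose order divides a product of two primes are modular. -/
theorem ModularIn.of_card_dvd {G : Type*} [Group G] {p q : ℕ} (hp : p.Prime) (hq : q.Prime)
    (h : Nat.card G ∣ p * q) (M : Subgroup G) : ModularIn M ⊤ := by
  -- The orders and indices along `⊥ ≤ X ≤ Z ≤ ⊤` multiply to a divisor of `p * q`, so one of the
  -- three steps is trivial.
  have key : ∀ X Z : Subgroup G, X ≤ Z → X = ⊥ ∨ X = Z ∨ Z = ⊤ := by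
    intro X Z hXZ
    rw [← Z.card_mul_index, ← Subgroup.relIndex_bot_left,
      ← Subgroup.relIndex_mul_relIndex ⊥ X Z bot_le hXZ, Subgroup.relIndex_bot_left] at h
    rcases Nat.eq_one_of_mul_mul_dvd_prime_mul hp hq h with h1 | h1 | h1
    · exact Or.inl (Subgroup.card_eq_one.1 h1)
    · exact Or.inr (Or.inl (hXZ.antisymm (Subgroup.relIndex_eq_one.1 h1)))
    · exact Or.inr (Or.inr (Subgroup.index_eq_one.1 h1))
  refine ⟨le_top, fun X Z hXZ _ => ?_, fun Y Z _ hMZ _ => ?_⟩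
  · rcases key X Z hXZ with rfl | rfl | rfl
    · rw [bot_sup_eq, bot_sup_eq]
    · rw [sup_eq_left.2 inf_le_right, inf_eq_right.2 le_sup_left]
    · rw [inf_top_eq, inf_top_eq]
  · rcases key M Z hMZ with rfl | rfl | rfl
    · rw [bot_sup_eq, bot_sup_eq]
    · rw [sup_eq_left.2 inf_le_right, inf_eq_right.2 le_sup_left]
    · rw [inf_top_eq, inf_top_eq]

section PowerAction

variable {G : Type*} [Group G] [Finite G]

/-- A subgroup `Q` which acts with exponent dividing the prime `q` on a normal subgroup `L` of prime
order is modular in `Q L`. -/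
theorem ModularIn.sup_of_prime_card {p q : ℕ} [hp : Fact p.Prime] (hq : q.Prime)
    {Q L : Subgroup G} [hL : L.Normal] (hcard : Nat.card L = p)
    (hpow : ∀ x ∈ Q, ∀ a ∈ L, x ^ q * a = a * x ^ q) : ModularIn Q (Q ⊔ L) := by
  -- The centralizer of `L` in `Q` is normal in `Q ⊔ L`. The index of `Q` there divides `p`, and `Q
  -- / E` embeds in the cyclic group `Aut L` with exponent, hence order, dividing `q`. So every
  -- subgroup of `(Q ⊔ L) / E` is modular.
  set E : Subgroup G := Q ⊓ Subgroup.centralizer (L : Set G) with hE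
  have hEQ : E ≤ Q := inf_le_left
  have hED : E ≤ Q ⊔ L := hEQ.trans le_sup_left
  have hQD : Q ≤ Q ⊔ L := le_sup_left
  have hQE : Q ≤ Subgroup.normalizer (E : Set G) := by
    intro x hx
    have hxE : ∀ y ∈ Q, ∀ n ∈ E, y * n * y⁻¹ ∈ E := fun y hy n hn => Subgroup.mem_inf.2
      ⟨Q.mul_mem (Q.mul_mem hy hn.1) (Q.inv_mem hy),
        (inferInstance : (Subgroup.centralizer (L : Set G)).Normal).conj_mem n hn.2 y⟩
    refine Subgroup.mem_normalizer_iff.2 fun n => ⟨hxE x hx n, fun hn => ?_⟩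
    have := hxE x⁻¹ (Q.inv_mem hx) _ hn
    simpa [mul_assoc] using this
  have hLE : L ≤ Subgroup.normalizer (E : Set G) :=
    (Subgroup.le_centralizer_iff.1 (inf_le_right : E ≤ _)).trans
      (Subgroup.centralizer_le_normalizer _)
  have hEn : (E.subgroupOf (Q ⊔ L)).Normal :=
    (Subgroup.normal_subgroupOf_iff_le_normalizer hED).2 (sup_le hQE hLE)
  have h1 : Q.relIndex (Q ⊔ L) ∣ p := by
    have h2 : Q.relIndex (Q ⊔ L) * (Q ⊓ L).relIndex Q = (Q ⊓ L).relIndex (Q ⊔ L) := by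
      rw [mul_comm]
      exact Subgroup.relIndex_mul_relIndex _ _ _ inf_le_left hQD
    have h3 : (Q ⊓ L).relIndex L * L.relIndex (Q ⊔ L) = (Q ⊓ L).relIndex (Q ⊔ L) :=
      Subgroup.relIndex_mul_relIndex _ _ _ inf_le_right le_sup_right
    rw [Subgroup.relIndex_sup_right, ← Subgroup.inf_relIndex_left Q L, ← h2] at h3
    have h4 : Q.relIndex (Q ⊔ L) = (Q ⊓ L).relIndex L :=
      (Nat.eq_of_mul_eq_mul_right (Nat.pos_of_ne_zero Subgroup.index_ne_zero_of_finite) h3).symm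
    rw [h4, ← hcard]
    exact Subgroup.relIndex_dvd_card _ _
  have h2 : E.relIndex Q ∣ q := by
    have : Fact (Nat.card L).Prime := ⟨hcard.symm ▸ hp.out⟩
    have : IsCyclic L := isCyclic_of_prime_card rfl
    have : IsCyclic (MulAut L) := isCyclic_of_surjective (IsCyclic.mulAutMulEquiv L).symm
      (IsCyclic.mulAutMulEquiv L).symm.surjective
    let φ : Q →* MulAut L := (MulAut.conjNormal (H := L)).comp Q.subtype
    have happ : ∀ (x : Q) (a : L), ((φ x a : L) : G) = x * a * (x : G)⁻¹ := fun _ _ => rfl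
    have hφ : φ.ker ≤ E.subgroupOf Q := by
      intro x hx
      refine Subgroup.mem_inf.2 ⟨x.2, Subgroup.mem_centralizer_iff.2 fun a ha => ?_⟩
      have h3 := happ x ⟨a, ha⟩
      rw [MonoidHom.mem_ker.1 hx, MulAut.one_apply, eq_mul_inv_iff_mul_eq] at h3
      exact h3
    refine (Subgroup.index_dvd_of_le hφ).trans ?_
    rw [Subgroup.index_ker, ← IsCyclic.exponent_eq_card]
    refine Monoid.exponent_dvd_of_forall_pow_eq_one ?_
    rintro ⟨_, ⟨x, rfl⟩⟩
    refine Subtype.ext ?_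
    change φ x ^ q = 1
    rw [← map_pow]
    refine MulEquiv.ext fun a => Subtype.ext ?_
    rw [happ, MulAut.one_apply, mul_inv_eq_iff_eq_mul]
    exact hpow x x.2 a a.2
  have hcardq : Nat.card (↥(Q ⊔ L) ⧸ E.subgroupOf (Q ⊔ L)) ∣ q * p := by
    have h3 : Nat.card (↥(Q ⊔ L) ⧸ E.subgroupOf (Q ⊔ L)) = E.relIndex (Q ⊔ L) := rfl
    rw [h3, ← Subgroup.relIndex_mul_relIndex E Q (Q ⊔ L) hEQ hQD]
    exact mul_dvd_mul h2 h1
  have h3 := (ModularIn.of_card_dvd hq hp.out hcardq ((Q.subgroupOf (Q ⊔ L)).map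
    (QuotientGroup.mk' (E.subgroupOf (Q ⊔ L))))).comap_surjective (QuotientGroup.mk'_surjective _)
  have hle : E.subgroupOf (Q ⊔ L) ≤ Q.subgroupOf (Q ⊔ L) := Subgroup.comap_mono hEQ
  rw [QuotientGroup.comap_map_mk', sup_eq_right.2 hle, Subgroup.comap_top] at h3
  have h4 := h3.map (Q ⊔ L).subtype
  rwa [Subgroup.map_subgroupOf_eq_of_le hQD, ← MonoidHom.range_eq_map, Subgroup.range_subtype]
    at h4

end PowerAction

/-! ### Abelian actions of bounded exponent yield submodularity -/

section Core

/-- `Q` acts on `N` as an abelian group whose exponent divides both `p - 1` and `q`. -/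
structure ActsAbelianly {G : Type*} [Group G] (Q N : Subgroup G) (p q : ℕ) : Prop where
  commutator : ∀ x ∈ Q, ∀ y ∈ Q, ∀ a ∈ N, (x * y)⁻¹ * (y * x) * a = a * ((x * y)⁻¹ * (y * x))
  pow_sub_one : ∀ x ∈ Q, ∀ a ∈ N, x ^ (p - 1) * a = a * x ^ (p - 1)
  pow : ∀ x ∈ Q, ∀ a ∈ N, x ^ q * a = a * x ^ q

theorem ActsAbelianly.mono {G : Type*} [Group G] {Q N N' : Subgroup G} {p q : ℕ}
    (h : ActsAbelianly Q N p q) (hN : N' ≤ N) : ActsAbelianly Q N' p q :=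
  ⟨fun x hx y hy a ha => h.1 x hx y hy a (hN ha), fun x hx a ha => h.2 x hx a (hN ha),
    fun x hx a ha => h.3 x hx a (hN ha)⟩

theorem ActsAbelianly.map {G G' : Type*} [Group G] [Group G'] {Q N : Subgroup G} {p q : ℕ}
    (h : ActsAbelianly Q N p q) (f : G →* G') : ActsAbelianly (Q.map f) (N.map f) p q := by
  refine ⟨?_, ?_, ?_⟩
  · rintro _ ⟨x, hx, rfl⟩ _ ⟨y, hy, rfl⟩ _ ⟨a, ha, rfl⟩
    simpa only [map_mul, map_inv] using congrArg f (h.1 x hx y hy a ha)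
  · rintro _ ⟨x, hx, rfl⟩ _ ⟨a, ha, rfl⟩
    simpa only [map_mul, map_pow] using congrArg f (h.2 x hx a ha)
  · rintro _ ⟨x, hx, rfl⟩ _ ⟨a, ha, rfl⟩
    simpa only [map_mul, map_pow] using congrArg f (h.3 x hx a ha)

theorem ActsAbelianly.of_map {G G' : Type*} [Group G] [Group G'] {Q N : Subgroup G} {p q : ℕ}
    {f : G →* G'} (hf : Function.Injective f) (h : ActsAbelianly (Q.map f) (N.map f) p q) :
    ActsAbelianly Q N p q := by
  refine ⟨fun x hx y hy a ha => hf ?_, fun x hx a ha => hf ?_, fun x hx a ha => hf ?_⟩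
  · simpa only [map_mul, map_inv] using h.1 _ ⟨x, hx, rfl⟩ _ ⟨y, hy, rfl⟩ _ ⟨a, ha, rfl⟩
  · simpa only [map_mul, map_pow] using h.2 _ ⟨x, hx, rfl⟩ _ ⟨a, ha, rfl⟩
  · simpa only [map_mul, map_pow] using h.3 _ ⟨x, hx, rfl⟩ _ ⟨a, ha, rfl⟩

variable {G : Type*} [Group G] [Finite G]

/-- `Q` acts on a minimal normal subgroup of `Q N` in `N` by scalars. -/
theorem ActsAbelianly.exists_conj_eq_pow {p q : ℕ} [hp : Fact p.Prime] {Q N L : Subgroup G}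
    (h : ActsAbelianly Q N p q) (hsup : Q ⊔ N = ⊤) (hab : ∀ a ∈ N, ∀ b ∈ N, a * b = b * a)
    (hexp : ∀ a ∈ N, a ^ p = 1) (hL : L.Normal) (hLN : L ≤ N) (hLb : L ≠ ⊥)
    (hmin : ∀ K : Subgroup G, K.Normal → K ≤ L → K = ⊥ ∨ K = L) {x : G} (hx : x ∈ Q) :
    ∃ k : ℕ, ∀ a ∈ L, x * a * x⁻¹ = a ^ k := by
  let _ : CommGroup L :=
    { (inferInstance : Group L) with
      mul_comm := fun a b => Subtype.ext (hab a (hLN a.2) b (hLN b.2)) }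
  have : Nontrivial L := (Subgroup.nontrivial_iff_ne_bot L).2 hLb
  let φ : L →* L := (MulAut.conjNormal (H := L) x).toMonoidHom
  have happ : ∀ a : L, ((φ a : L) : G) = x * a * x⁻¹ := fun _ => rfl
  have hiter : ∀ (n : ℕ) (a : L), ((φ^[n] a : L) : G) = x ^ n * a * (x ^ n)⁻¹ := by
    intro n a
    induction n with
    | zero => simp
    | succ n ih => rw [Function.iterate_succ_apply', happ, ih, pow_succ']; group
  -- Since `x ^ (p - 1)` acts trivially, conjugation by `x` equals its own `p`-th iterate and so has
  -- an eigenvector.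
  obtain ⟨k, a, ha1, hak⟩ := φ.exists_apply_eq_pow (p := p)
    (fun a => Subtype.ext (hexp a (hLN a.2))) fun a => Subtype.ext (by
      have h1 := h.pow_sub_one x hx a (hLN a.2)
      rw [hiter, happ, ← Nat.sub_add_cancel hp.out.one_le, pow_succ']
      calc x * x ^ (p - 1) * (a : G) * (x * x ^ (p - 1))⁻¹
          = x * (x ^ (p - 1) * a) * (x ^ (p - 1))⁻¹ * x⁻¹ := by group
        _ = x * a * x⁻¹ := by rw [h1]; group)
  let E : Subgroup G :=
    { carrier := {a | a ∈ L ∧ x * a * x⁻¹ = a ^ k}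
      one_mem' := ⟨L.one_mem, by simp⟩
      mul_mem' := fun {a b} ha hb => ⟨L.mul_mem ha.1 hb.1, by
        have hcomm : Commute a b := hab a (hLN ha.1) b (hLN hb.1)
        rw [hcomm.mul_pow, ← ha.2, ← hb.2]; group⟩
      inv_mem' := fun {a} ha => ⟨L.inv_mem ha.1, by rw [inv_pow, ← ha.2]; group⟩ }
  -- The eigenspace `E` is invariant because `x` and `y` induce commuting automorphisms. As `N` is
  -- abelian, `E` is then normal in `QN`, and minimality makes it all of `L`.
  have hQE : ∀ y ∈ Q, ∀ a ∈ E, y * a * y⁻¹ ∈ E := by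
    intro y hy a ha
    refine ⟨hL.conj_mem a ha.1 y, ?_⟩
    have h1 := h.commutator y hy x hx a (hLN ha.1)
    calc x * (y * a * y⁻¹) * x⁻¹
        = y * x * ((y * x)⁻¹ * (x * y) * a) * ((y * x)⁻¹ * (x * y))⁻¹ * (y * x)⁻¹ := by group
      _ = y * (x * a * x⁻¹) * y⁻¹ := by rw [h1]; group
      _ = (y * a * y⁻¹) ^ k := by rw [ha.2, conj_pow]
  have hEn : E.Normal := by
    rw [← Subgroup.normalizer_eq_top_iff, eq_top_iff, ← hsup]
    refine sup_le (fun y hy => Subgroup.mem_normalizer_iff.2 fun n => ⟨hQE y hy n, fun hn => ?_⟩) ?_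
    · have := hQE y⁻¹ (Q.inv_mem hy) _ hn
      simpa [mul_assoc] using this
    · refine le_trans (fun b hb => ?_) (Subgroup.centralizer_le_normalizer _)
      exact Subgroup.mem_centralizer_iff.2 fun a ha => hab a (hLN ha.1) b hb
  rcases hmin E hEn (fun a ha => ha.1) with h1 | h1
  · exfalso
    have haE : (a : G) ∈ E := ⟨a.2, (happ a).symm.trans (congrArg Subtype.val hak)⟩
    rw [h1, Subgroup.mem_bot] at haE
    exact ha1 (Subtype.ext haE)
  · exact ⟨k, fun a ha => (h1 ▸ ha : a ∈ E).2⟩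

/-- Scalars preserve every cyclic subgroup of `L`, so each of these is normal and minimality leaves
only one that is nontrivial. -/
theorem ActsAbelianly.card_eq_prime {p q : ℕ} [hp : Fact p.Prime] {Q N L : Subgroup G}
    (h : ActsAbelianly Q N p q) (hsup : Q ⊔ N = ⊤) (hab : ∀ a ∈ N, ∀ b ∈ N, a * b = b * a)
    (hexp : ∀ a ∈ N, a ^ p = 1) (hL : L.Normal) (hLN : L ≤ N) (hLb : L ≠ ⊥)
    (hmin : ∀ K : Subgroup G, K.Normal → K ≤ L → K = ⊥ ∨ K = L) : Nat.card L = p := by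
  obtain ⟨a, ha, ha1⟩ := (Subgroup.bot_or_exists_ne_one L).resolve_left hLb
  have hle : Subgroup.zpowers a ≤ L := by rwa [Subgroup.zpowers_le]
  have hQ : ∀ x ∈ Q, ∀ b ∈ Subgroup.zpowers a, x * b * x⁻¹ ∈ Subgroup.zpowers a := by
    intro x hx b hb
    obtain ⟨k, hk⟩ := h.exists_conj_eq_pow hsup hab hexp hL hLN hLb hmin hx
    rw [hk b (hle hb)]
    exact pow_mem hb k
  have hn : (Subgroup.zpowers a).Normal := by
    rw [← Subgroup.normalizer_eq_top_iff, eq_top_iff, ← hsup]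
    refine sup_le (fun y hy => Subgroup.mem_normalizer_iff.2 fun n => ⟨hQ y hy n, fun hn => ?_⟩) ?_
    · have := hQ y⁻¹ (Q.inv_mem hy) _ hn
      simpa [mul_assoc] using this
    · refine le_trans (fun b hb => ?_) (Subgroup.centralizer_le_normalizer _)
      exact Subgroup.mem_centralizer_iff.2 fun c hc => hab c (hLN (hle hc)) b hb
  rcases hmin _ hn hle with h1 | h1
  · exact absurd (Subgroup.zpowers_eq_bot.1 h1) ha1
  · rw [← h1, Nat.card_zpowers]
    exact orderOf_eq_prime (hexp a (hLN ha)) ha1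

end Core

/-- With `L ≤ N` minimal normal, `Q` is modular in `QL` because `L` has order `p`; the hypotheses
pass to `G / L`, where induction supplies the chain from `QL` to the top. -/
theorem ActsAbelianly.submodularIn_top {p q : ℕ} (hp : p.Prime) (hq : q.Prime) (n : ℕ) :
    ∀ (G : Type u) [Group G] [Finite G], Nat.card G = n → ∀ (Q N : Subgroup G), N.Normal →
      Q ⊔ N = ⊤ → ActsAbelianly Q N p q → (∀ a ∈ N, ∀ b ∈ N, a * b = b * a) →
      (∀ a ∈ N, a ^ p = 1) → SubmodularIn Q ⊤ := by
  induction n using Nat.strong_induction_on with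
  | h n ih =>
  intro G _ _ hn Q N hN hsup h hab hexp
  have hpf : Fact p.Prime := ⟨hp⟩
  by_cases hNb : N = ⊥
  · rw [hNb, sup_bot_eq] at hsup
    rw [hsup]
    exact Relation.ReflTransGen.refl
  obtain ⟨L, hL, hLN, hLb, hmin⟩ := Subgroup.exists_minimal_normal_le hN hNb
  have hcard := h.card_eq_prime hsup hab hexp hL hLN hLb hmin
  have hmod : ModularIn Q (Q ⊔ L) :=
    ModularIn.sup_of_prime_card (p := p) hq hcard (h.mono hLN).pow
  have hquot := ih _ (hn ▸ Subgroup.card_quotient_lt_of_ne_bot hLb) (G ⧸ L) rfl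
    (Q.map (QuotientGroup.mk' L)) (N.map (QuotientGroup.mk' L))
    (hN.map _ (QuotientGroup.mk'_surjective L))
    (by rw [← Subgroup.map_sup, hsup,
      Subgroup.map_top_of_surjective _ (QuotientGroup.mk'_surjective L)])
    (h.map _)
    (by
      rintro _ ⟨a, ha, rfl⟩ _ ⟨b, hb, rfl⟩
      rw [← map_mul, hab a ha b hb, map_mul])
    (by
      rintro _ ⟨a, ha, rfl⟩
      rw [← map_pow, hexp a ha, map_one])
  have h1 := hquot.comap_surjective (QuotientGroup.mk'_surjective L)
  rw [QuotientGroup.comap_map_mk', sup_comm, Subgroup.comap_top] at h1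
  exact Relation.ReflTransGen.head hmod h1

section

variable {G : Type u} [Group G] [Finite G]

theorem ActsAbelianly.submodularIn_sup {p q : ℕ} (hp : p.Prime) (hq : q.Prime)
    {Q N : Subgroup G} [hN : N.Normal] (h : ActsAbelianly Q N p q)
    (hab : ∀ a ∈ N, ∀ b ∈ N, a * b = b * a) (hexp : ∀ a ∈ N, a ^ p = 1) :
    SubmodularIn Q (Q ⊔ N) := by
  have hQ : (Q.subgroupOf (Q ⊔ N)).map (Q ⊔ N).subtype = Q :=
    Subgroup.map_subgroupOf_eq_of_le le_sup_left
  have hN' : (N.subgroupOf (Q ⊔ N)).map (Q ⊔ N).subtype = N :=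
    Subgroup.map_subgroupOf_eq_of_le le_sup_right
  have htop : (⊤ : Subgroup ↥(Q ⊔ N)).map (Q ⊔ N).subtype = Q ⊔ N := by
    rw [← MonoidHom.range_eq_map, Subgroup.range_subtype]
  have h1 := ActsAbelianly.submodularIn_top hp hq _ ↥(Q ⊔ N) rfl (Q.subgroupOf (Q ⊔ N))
    (N.subgroupOf (Q ⊔ N)) inferInstance
    (Subgroup.map_injective (Q ⊔ N).subtype_injective (by
      rw [Subgroup.map_sup, hQ, hN', htop]))
    (ActsAbelianly.of_map (Q ⊔ N).subtype_injective (by rwa [hQ, hN']))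
    (fun a ha b hb => Subtype.ext (hab a ha b hb)) (fun a ha => Subtype.ext (hexp a ha))
  have h2 := h1.map (Q ⊔ N).subtype
  rwa [hQ, htop] at h2

/-! ### From the screen back to submodular Sylow subgroups along a chief series -/

omit [Finite G] in
theorem IsChiefFactor.isSolvable_map {H K : Subgroup G} [H.Normal] [K.Normal]
    (h : IsChiefFactor H K) (hsol : Group.IsSolvable (G ⧸ factorCentralizer H K)) :
    Group.IsSolvable (H.map (QuotientGroup.mk' K)) := by
  have hn := h.map_normal
  set N := H.map (QuotientGroup.mk' K) with hN
  set Z := Subgroup.centralizer (N : Set (G ⧸ K)) with hZ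
  have h1 : Group.IsSolvable ((G ⧸ K) ⧸ Z) := by
    refine Group.isSolvable_of_surjective (f := QuotientGroup.map (factorCentralizer H K) Z
      (QuotientGroup.mk' K) le_rfl) ?_
    exact QuotientGroup.map_surjective_of_surjective _ _ _
      ((QuotientGroup.mk'_surjective Z).comp (QuotientGroup.mk'_surjective K)) _
  have h2 : Group.IsSolvable (Subgroup.center N) :=
    Group.isSolvable_of_comm fun a b => Subtype.ext (Subgroup.mem_center_iff.1 b.2 a)
  -- The kernel of `N → (G / K) / Z` is central in `N`, and the target is a quotient of the soluble
  -- group `G / C_G(H / K)`.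
  refine Group.isSolvable_of_ker_le_range (Subgroup.center N).subtype
    ((QuotientGroup.mk' Z).comp N.subtype) ?_
  rw [Subgroup.range_subtype]
  intro x hx
  have hxZ : (x : G ⧸ K) ∈ Z := (QuotientGroup.eq_one_iff _).1 hx
  exact Subgroup.mem_center_iff.2 fun y =>
    Subtype.ext (Subgroup.mem_centralizer_iff.1 hxZ y y.2)

theorem exists_isChiefFactor {K : Subgroup G} [hK : K.Normal] (hne : K ≠ ⊤) :
    ∃ H : Subgroup G, IsChiefFactor H K := by
  have hmc := Subgroup.map_comap_eq_self_of_surjective (QuotientGroup.mk'_surjective K)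
  have hker : ∀ L : Subgroup (G ⧸ K), K ≤ L.comap (QuotientGroup.mk' K) := fun L => by
    have := Subgroup.ker_le_comap (QuotientGroup.mk' K) L
    rwa [QuotientGroup.ker_mk'] at this
  have htop : (⊤ : Subgroup (G ⧸ K)) ≠ ⊥ := by
    intro htb
    apply hne
    rw [← QuotientGroup.ker_mk' K, MonoidHom.ker_eq_top_iff]
    ext x
    exact Subgroup.mem_bot.1 (htb ▸ Subgroup.mem_top (QuotientGroup.mk' K x))
  obtain ⟨L, hL, -, hLb, hmin⟩ := Subgroup.exists_minimal_normal_le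
    (Subgroup.normal_of_characteristic (⊤ : Subgroup (G ⧸ K))) htop
  refine ⟨L.comap (QuotientGroup.mk' K), hL.comap _, hK, lt_of_le_of_ne (hker L) fun heq => ?_,
    fun M hM hKM hML => ?_⟩
  · apply hLb
    rw [← hmc L, ← heq, QuotientGroup.map_mk'_self]
  · have hcm : (M.map (QuotientGroup.mk' K)).comap (QuotientGroup.mk' K) = M := by
      rw [QuotientGroup.comap_map_mk', sup_eq_right.2 hKM]
    rcases hmin _ (hM.map _ (QuotientGroup.mk'_surjective K))
      (Subgroup.map_le_iff_le_comap.2 hML) with h1 | h1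
    · left
      rw [← hcm, h1, MonoidHom.comap_bot, QuotientGroup.ker_mk']
    · right
      rw [← hcm, h1]

/-- Modulo `K` the screen condition becomes `ActsAbelianly`. The case `q = p` needs no separate
treatment: exponents dividing `p - 1` and `p` mean a trivial action. -/
theorem IsChiefFactor.submodularIn_sup {H K : Subgroup G} [H.Normal] [K.Normal]
    (h : IsChiefFactor H K) {p : Nat.Primes} (hpH : (p : ℕ) ∣ K.relIndex H)
    (hG : (GroupClass.sylowScreen p).Mem (G ⧸ factorCentralizer H K)) {q : ℕ} [hq : Fact q.Prime]
    (P : Sylow q G) : SubmodularIn ((P : Subgroup G) ⊔ K) ((P : Subgroup G) ⊔ H) := by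
  obtain ⟨hsol, hG⟩ := (GroupClass.mem_sylowScreen_quotient_iff _).1 hG
  have hn := h.map_normal
  obtain ⟨hexp, hab⟩ := h.elementaryAbelian (h.isSolvable_map hsol) p.2 hpH
  have hact : ActsAbelianly ((P : Subgroup G).map (QuotientGroup.mk' K))
      (H.map (QuotientGroup.mk' K)) p q := by
    refine ⟨?_, ?_, ?_⟩
    · rintro _ ⟨x, hx, rfl⟩ _ ⟨y, hy, rfl⟩ a ha
      exact mem_factorCentralizer_iff_commute.1 ((hG q P x hx).1 y hy) a ha
    · rintro _ ⟨x, hx, rfl⟩ a ha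
      exact mem_factorCentralizer_iff_commute.1 (hG q P x hx).2.1 a ha
    · rintro _ ⟨x, hx, rfl⟩ a ha
      exact mem_factorCentralizer_iff_commute.1 (hG q P x hx).2.2 a ha
  have h1 := (hact.submodularIn_sup p.2 hq.out hab hexp).comap_surjective
    (QuotientGroup.mk'_surjective K)
  rw [← Subgroup.map_sup, QuotientGroup.comap_map_mk', QuotientGroup.comap_map_mk', sup_comm,
    sup_eq_right.2 (h.lt.le.trans le_sup_right)] at h1
  exact h1

/-- Climb a chief series from any normal `K` to `G`: each factor `H / K` gives a submodular step
from `PK` to `PH`. The case of trivial `K` is the claim. -/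
theorem sylowSubmodular_of_mem_localClass
    (hG : (GroupClass.localClass GroupClass.sylowScreen.{u}).Mem G) : SylowSubmodular G := by
  intro q hq P
  have key : ∀ K : Subgroup G, K.Normal → SubmodularIn ((P : Subgroup G) ⊔ K) ⊤ := by
    intro K
    induction K using WellFoundedGT.induction with
    | ind K ih =>
    intro hK
    by_cases hKt : K = ⊤
    · rw [hKt, sup_top_eq]
      exact Relation.ReflTransGen.refl
    obtain ⟨H, hHK⟩ := exists_isChiefFactor hKt
    have hH := hHK.normal_top
    refine SubmodularIn.trans ?_ (ih H hHK.lt hH)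
    obtain ⟨p, hp, hpH⟩ := Nat.exists_prime_and_dvd
      (fun h1 : K.relIndex H = 1 => not_le_of_gt hHK.lt (Subgroup.relIndex_eq_one.1 h1))
    exact hHK.submodularIn_sup (p := ⟨p, hp⟩) hpH (hG.2 H K hHK ⟨p, hp⟩ hpH) P
  have := key ⊥ Subgroup.normal_bot
  rwa [sup_bot_eq] at this

end

/-! ### Equality of the two classes and the theorem -/

theorem GroupClass.ext_mem {X Y : GroupClass.{u}}
    (h : ∀ (G : Type u) [Group G], X.Mem G ↔ Y.Mem G) : X = Y := by
  cases X
  cases Y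
  congr
  funext G _
  exact propext (h G)

theorem GroupClass.submodularSylow_hasLocalScreen :
    GroupClass.submodularSylow.{u}.HasLocalScreen GroupClass.sylowScreen := by
  refine ⟨GroupClass.sylowScreen_isFormation, GroupClass.ext_mem fun G _ => ?_⟩
  rw [GroupClass.mem_submodularSylow_iff]
  constructor
  · rintro ⟨_, hG⟩
    exact hG.mem_localClass
  · intro hG
    have := hG.1
    exact ⟨hG.1, sylowSubmodular_of_mem_localClass hG⟩

theorem theorem3p6 :
    GroupClass.submodularSylow.{u}.IsLocalFormation ∧
    GroupClass.submodularSylow.{u}.HasLocalScreen (fun p : Nat.Primes =>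
      GroupClass.solubleWithSylowIn
        ((GroupClass.abelianOfExponentDvd ((p : ℕ) - 1)).inter
          GroupClass.abelianOfSquarefreeExponent)) :=
  ⟨⟨GroupClass.submodularSylow_isFormation, _, GroupClass.submodularSylow_hasLocalScreen⟩,
    GroupClass.submodularSylow_hasLocalScreen⟩
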